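/- Let $q\in\mathbb C$ with $|q|=1$ not be a root of unity, fix a square root $q^{1/2}$ of $q$, and let $\mu,\nu\in\mathbb R$. Let $A=SL_q(2,\mathbb R)$ be the unital complex $*$-algebra generated by four real (self-adjoint) elements $a,b,c,d$ with relations $$ab=q\,ba,\quad ac=q\,ca,\quad bc=cb,\quad bd=q\,db,\quad cd=q\,dc,\quad da-q^{-1}bc=1=ad-q\,bc,$$ with the coproduct $\Delta:A\to A\otimes A$, the algebra homomorphism given by $\Delta a=a\otimes a+b\otimes c$, $\Delta b=a\otimes b+b\otimes d$, $\Delta c=c\otimes a+d\otimes c$, $\Delta d=c\otimes b+d\otimes d$. Let $\mathcal C_{\mu\nu}\subset A$ be the linear span of $a-d+2q^{1/2}\mu\,b$ and $q\nu\,b+c$, let $\mathcal R_{\mu\nu}=\mathcal C_{\mu\nu}A$ be the right ideal it generates, let $r_{\mu\nu}:A\to A/\mathcal R_{\mu\nu}$ be the quotient map, and let $$B^{r_{\mu\nu}}=\{x\in A:\ (\mathrm{id}\otimes r_{\mu\nu})\Delta x=x\otimes r_{\mu\nu}(1)\}$$ be the quantum homogeneous space of right coinvariants. Put $$z_1=q^{-1/2}(ac+\nu\,bd)+2\mu\,bc,\qquad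 z_2=c^2+\nu\,d^2+2\mu q^{-1/2}cd,\qquad z_3=a^2+\nu\,b^2+2\mu q^{-1/2}ab .$$ Then $B^{r_{\mu\nu}}$ is a left comodule subalgebra of $A$ (a unital subalgebra with $\Delta(B^{r_{\mu\nu}})\subset A\otimes B^{r_{\mu\nu}}$), and it is generated as a unital complex algebra by $z_1,z_2,z_3$. The elements $z_1,z_2,z_3$ are real ($z_i^*=z_i$) and satisfy $$z_1z_2=q^2z_2z_1,\qquad z_1z_3=q^{-2}z_3z_1,\qquad z_3z_2=\nu+q^2z_1^2+2\mu q\,z_1 .$$ -/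

import Mathlib

open scoped TensorProduct

noncomputable section

namespace SLq

/-- The names of the four generators of the function algebra on `SL_q(2, ℝ)`. -/
inductive Gen : Type
  | a | b | c | d

/-- The generators, as elements of the free complex algebra on them. -/
abbrev free (g : Gen) : FreeAlgebra ℂ Gen := FreeAlgebra.ι ℂ g

/-- The defining relations of the function algebra on `SL_q(2, ℝ)`. -/
inductive Rel (q : ℂ) : FreeAlgebra ℂ Gen → FreeAlgebra ℂ Gen → Prop
  | ab : Rel q (free .a * free .b) (q • (free .b * free .a))
  | ac : Rel q (free .a * free .c) (q • (free .c * free .a))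
  | bc : Rel q (free .b * free .c) (free .c * free .b)
  | bd : Rel q (free .b * free .d) (q • (free .d * free .b))
  | cd : Rel q (free .c * free .d) (q • (free .d * free .c))
  | da : Rel q (free .d * free .a - q⁻¹ • (free .b * free .c)) 1
  | ad : Rel q (free .a * free .d - q • (free .b * free .c)) 1

/-- The function algebra on the quantum group `SL_q(2, ℝ)`, where `q` is a complex number of
modulus one: the unital complex algebra generated by `a, b, c, d` with the relations `Rel`. -/
def Fun (q : Circle) : Type := RingQuot (Rel (q : ℂ))

variable (q : Circle)

instance : Ring (Fun q) := inferInstanceAs (Ring (RingQuot (Rel (q : ℂ))))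

instance : Algebra ℂ (Fun q) := inferInstanceAs (Algebra ℂ (RingQuot (Rel (q : ℂ))))

/-- The generators of the function algebra. -/
def gen (g : Gen) : Fun q := RingQuot.mkAlgHom ℂ (Rel (q : ℂ)) (free g)

abbrev a : Fun q := gen q .a
abbrev b : Fun q := gen q .b
abbrev c : Fun q := gen q .c
abbrev d : Fun q := gen q .d

theorem rel_ab : a q * b q = (q : ℂ) • (b q * a q) := by
  simpa using! RingQuot.mkAlgHom_rel ℂ (Rel.ab (q := (q : ℂ)))

theorem rel_ac : a q * c q = (q : ℂ) • (c q * a q) := by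
  simpa using! RingQuot.mkAlgHom_rel ℂ (Rel.ac (q := (q : ℂ)))

theorem rel_bc : b q * c q = c q * b q := by
  simpa using! RingQuot.mkAlgHom_rel ℂ (Rel.bc (q := (q : ℂ)))

theorem rel_bd : b q * d q = (q : ℂ) • (d q * b q) := by
  simpa using! RingQuot.mkAlgHom_rel ℂ (Rel.bd (q := (q : ℂ)))

theorem rel_cd : c q * d q = (q : ℂ) • (d q * c q) := by
  simpa using! RingQuot.mkAlgHom_rel ℂ (Rel.cd (q := (q : ℂ)))

theorem rel_da : d q * a q - (q : ℂ)⁻¹ • (b q * c q) = 1 := by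
  simpa using! RingQuot.mkAlgHom_rel ℂ (Rel.da (q := (q : ℂ)))

theorem rel_ad : a q * d q - (q : ℂ) • (b q * c q) = 1 := by
  simpa using! RingQuot.mkAlgHom_rel ℂ (Rel.ad (q := (q : ℂ)))

section lift

variable {q} {T : Type*} [Ring T] [Algebra ℂ T]

/-- The universal property: an algebra homomorphism out of the function algebra is given by the
images of the four generators, which have to satisfy the relations. -/
def lift (f : Gen → T)
    (hab : f .a * f .b = (q : ℂ) • (f .b * f .a))
    (hac : f .a * f .c = (q : ℂ) • (f .c * f .a))
    (hbc : f .b * f .c = f .c * f .b)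
    (hbd : f .b * f .d = (q : ℂ) • (f .d * f .b))
    (hcd : f .c * f .d = (q : ℂ) • (f .d * f .c))
    (hda : f .d * f .a - (q : ℂ)⁻¹ • (f .b * f .c) = 1)
    (had : f .a * f .d - (q : ℂ) • (f .b * f .c) = 1) : Fun q →ₐ[ℂ] T :=
  RingQuot.liftAlgHom ℂ ⟨FreeAlgebra.lift ℂ f, by
    intro x y h
    cases h <;> simpa using by assumption⟩

@[simp]
theorem lift_gen (f : Gen → T) (h₁ h₂ h₃ h₄ h₅ h₆ h₇) (g : Gen) :
    lift (q := q) f h₁ h₂ h₃ h₄ h₅ h₆ h₇ (gen q g) = f g := by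
  exact (RingQuot.liftAlgHom_mkAlgHom_apply ℂ (FreeAlgebra.lift ℂ f) _ (free g)).trans
    (FreeAlgebra.lift_ι_apply f g)

theorem hom_ext {f₁ f₂ : Fun q →ₐ[ℂ] T} (h : ∀ g, f₁ (gen q g) = f₂ (gen q g)) : f₁ = f₂ := by
  refine RingQuot.ringQuot_ext' ℂ (s := Rel (q : ℂ)) f₁ f₂ ?_
  refine FreeAlgebra.hom_ext ?_
  funext g
  exact h g

end lift

/-! Rewriting rules for products of two generators. -/

theorem mul_ba : b q * a q = (q : ℂ)⁻¹ • (a q * b q) := by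
  rw [rel_ab, smul_smul, inv_mul_cancel₀ q.coe_ne_zero, one_smul]

theorem mul_ca : c q * a q = (q : ℂ)⁻¹ • (a q * c q) := by
  rw [rel_ac, smul_smul, inv_mul_cancel₀ q.coe_ne_zero, one_smul]

theorem mul_db : d q * b q = (q : ℂ)⁻¹ • (b q * d q) := by
  rw [rel_bd, smul_smul, inv_mul_cancel₀ q.coe_ne_zero, one_smul]

theorem mul_dc : d q * c q = (q : ℂ)⁻¹ • (c q * d q) := by
  rw [rel_cd, smul_smul, inv_mul_cancel₀ q.coe_ne_zero, one_smul]

theorem mul_da : d q * a q = 1 + (q : ℂ)⁻¹ • (b q * c q) := sub_eq_iff_eq_add.mp (rel_da q)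

theorem mul_ad : a q * d q = 1 + (q : ℂ) • (b q * c q) := sub_eq_iff_eq_add.mp (rel_ad q)

/-- The values of the coproduct on the generators: `Δ T = T ⊗ T` for the matrix
`T = (a, b; c, d)`. -/
def comulGen : Gen → Fun q ⊗[ℂ] Fun q
  | .a => a q ⊗ₜ a q + b q ⊗ₜ c q
  | .b => a q ⊗ₜ b q + b q ⊗ₜ d q
  | .c => c q ⊗ₜ a q + d q ⊗ₜ c q
  | .d => c q ⊗ₜ b q + d q ⊗ₜ d q

/-- The coproduct of the function algebra. -/
def comulHom : Fun q →ₐ[ℂ] Fun q ⊗[ℂ] Fun q := by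
  have hq : (q : ℂ) ≠ 0 := q.coe_ne_zero
  refine lift (comulGen q) ?_ ?_ ?_ ?_ ?_ ?_ ?_ <;>
  · simp only [comulGen, mul_add, add_mul, Algebra.TensorProduct.tmul_mul_tmul, mul_ba, mul_ca,
      mul_db, mul_dc, mul_da, mul_ad, ← rel_bc, TensorProduct.tmul_add, TensorProduct.add_tmul,
      TensorProduct.tmul_smul, ← TensorProduct.smul_tmul', Algebra.TensorProduct.one_def]
    match_scalars <;> field_simp <;> ring

/-- The values of the counit on the generators. -/
def counitGen : Gen → ℂ
  | .a => 1
  | .b => 0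
  | .c => 0
  | .d => 1

/-- The counit of the function algebra. -/
def counitHom : Fun q →ₐ[ℂ] ℂ :=
  lift counitGen (by simp [counitGen]) (by simp [counitGen]) (by simp [counitGen])
    (by simp [counitGen]) (by simp [counitGen]) (by simp [counitGen]) (by simp [counitGen])

theorem comulHom_gen (g : Gen) : comulHom q (gen q g) = comulGen q g := by
  simp [comulHom]

theorem counitHom_gen (g : Gen) : counitHom q (gen q g) = counitGen g := by
  simp [counitHom]

instance : Bialgebra ℂ (Fun q) :=
  Bialgebra.ofAlgHom (comulHom q) (counitHom q)
    (by
      refine hom_ext fun g => ?_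
      cases g <;> simp [comulHom_gen, comulGen, TensorProduct.add_tmul, TensorProduct.tmul_add] <;>
        abel)
    (by
      refine hom_ext fun g => ?_
      cases g <;> simp [comulHom_gen, comulGen, counitHom_gen, counitGen])
    (by
      refine hom_ext fun g => ?_
      cases g <;> simp [comulHom_gen, comulGen, counitHom_gen, counitGen])

/-- The opposite of the function algebra, with `ℂ` acting through complex conjugation; algebra
homomorphisms into it are antilinear antimultiplicative maps into the function algebra. -/
def ConjOp : Type := (Fun q)ᵐᵒᵖ

instance : Ring (ConjOp q) := inferInstanceAs (Ring (Fun q)ᵐᵒᵖ)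

instance : Algebra ℂ (ConjOp q) := Algebra.compHom (Fun q)ᵐᵒᵖ (starRingEnd ℂ)

/-- The identity map into the conjugate opposite algebra. -/
def toConjOp (x : Fun q) : ConjOp q := MulOpposite.op x

/-- The identity map from the conjugate opposite algebra. -/
def ofConjOp (x : ConjOp q) : Fun q := MulOpposite.unop x

@[simp] theorem of_to (x : Fun q) : ofConjOp q (toConjOp q x) = x := rfl
@[simp] theorem to_of (x : ConjOp q) : toConjOp q (ofConjOp q x) = x := rfl
theorem to_mul (x y : Fun q) : toConjOp q (x * y) = toConjOp q y * toConjOp q x := rfl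
theorem to_add (x y : Fun q) : toConjOp q (x + y) = toConjOp q x + toConjOp q y := rfl
theorem to_sub (x y : Fun q) : toConjOp q (x - y) = toConjOp q x - toConjOp q y := rfl
theorem to_one : toConjOp q 1 = 1 := rfl
theorem of_mul (x y : ConjOp q) : ofConjOp q (x * y) = ofConjOp q y * ofConjOp q x := rfl
theorem of_add (x y : ConjOp q) : ofConjOp q (x + y) = ofConjOp q x + ofConjOp q y := rfl
theorem of_zero : ofConjOp q 0 = 0 := rfl
theorem of_one : ofConjOp q 1 = 1 := rfl

theorem smul_to (z : ℂ) (x : Fun q) :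
    z • toConjOp q x = toConjOp q ((starRingEnd ℂ z) • x) := rfl

theorem of_smul (z : ℂ) (x : ConjOp q) :
    ofConjOp q (z • x) = (starRingEnd ℂ z) • ofConjOp q x := rfl

/-- The involution, as a homomorphism into the conjugate opposite algebra; it is the identity on
the four generators. -/
def starHom : Fun q →ₐ[ℂ] ConjOp q := by
  have hq : (q : ℂ) ≠ 0 := q.coe_ne_zero
  have hc : (starRingEnd ℂ) (q : ℂ) = (q : ℂ)⁻¹ := by
    rw [← Circle.coe_inv_eq_conj, Circle.coe_inv]
  refine lift (fun g => toConjOp q (gen q g)) ?_ ?_ ?_ ?_ ?_ ?_ ?_ <;>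
  simp only [← to_mul, smul_to, ← to_sub, ← to_one, hc, map_inv₀, inv_inv] <;> congr 1
  · exact mul_ba q
  · exact mul_ca q
  · exact (rel_bc q).symm
  · exact mul_db q
  · exact mul_dc q
  · rw [← rel_bc]; exact rel_ad q
  · rw [← rel_bc]; exact rel_da q

/-- The `*`-structure of `SL_q(2, ℝ)`: the antilinear antimultiplicative involution for which
`a, b, c, d` are real. -/
instance : Star (Fun q) := ⟨fun x => ofConjOp q (starHom q x)⟩

theorem star_def (x : Fun q) : star x = ofConjOp q (starHom q x) := rfl

theorem star_gen (g : Gen) : star (gen q g) = gen q g := by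
  simp [star_def, starHom]

theorem star_mul_aux (x y : Fun q) : star (x * y) = star y * star x := by
  simp [star_def, of_mul]

theorem star_add_aux (x y : Fun q) : star (x + y) = star x + star y := by
  simp [star_def, of_add]

theorem star_smul_aux (z : ℂ) (x : Fun q) : star (z • x) = star z • star x := by
  simp [star_def, of_smul]

theorem star_one_aux : star (1 : Fun q) = 1 := by
  simp [star_def, of_one]

/-- The square of the involution, as a homomorphism of complex algebras. -/
def starStarHom : Fun q →ₐ[ℂ] Fun q where
  toFun x := star (star x)
  map_one' := by simp [star_one_aux]
  map_mul' x y := by simp [star_mul_aux]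
  map_zero' := by simp [star_def, of_zero]
  map_add' x y := by simp [star_add_aux]
  commutes' z := by simp [Algebra.algebraMap_eq_smul_one, star_smul_aux, star_one_aux]

theorem star_star_aux (x : Fun q) : star (star x) = x := by
  have h : starStarHom q = AlgHom.id ℂ (Fun q) := hom_ext fun g => by
    simp [starStarHom, star_gen]
  exact DFunLike.congr_fun h x

instance : StarRing (Fun q) where
  star_involutive := star_star_aux q
  star_mul := star_mul_aux q
  star_add := star_add_aux q

instance : StarModule ℂ (Fun q) := ⟨star_smul_aux q⟩

/-! In the following definitions `s` is a square root `q^{1/2}` of `q`. -/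

variable (s : Circle) (μ ν : ℝ)

/-- The linear span of `a - d + 2 q^{1/2} μ b` and `q ν b + c`. -/
def coideal : Submodule ℂ (Fun q) :=
  Submodule.span ℂ
    {a q - d q + (2 * s * μ : ℂ) • b q, (q * ν : ℂ) • b q + c q}

/-- The right ideal `coideal * Fun q` generated by the coideal, as a linear subspace. -/
def rightIdeal : Submodule ℂ (Fun q) := coideal q s μ ν * ⊤

/-- The (space underlying the) coisotropic quantum right subgroup: the quotient of the function
algebra by the right ideal. -/
abbrev Subgp : Type := Fun q ⧸ rightIdeal q s μ ν

/-- The quotient map onto the coisotropic quantum subgroup. -/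
def proj : Fun q →ₗ[ℂ] Subgp q s μ ν := (rightIdeal q s μ ν).mkQ

/-- The quantum homogeneous space of right coinvariants
`{x | (id ⊗ r) (Δ x) = x ⊗ r 1}`, where `r` is the quotient map. -/
def homogeneousSpace : Submodule ℂ (Fun q) where
  carrier := {x | (proj q s μ ν).lTensor (Fun q) (Coalgebra.comul (R := ℂ) x)
    = x ⊗ₜ[ℂ] proj q s μ ν 1}
  zero_mem' := by simp
  add_mem' {x y} hx hy := by
    simp only [Set.mem_ofPred_eq] at hx hy ⊢
    simp only [map_add, hx, hy, TensorProduct.add_tmul]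
  smul_mem' z x hx := by
    simp only [Set.mem_ofPred_eq] at hx ⊢
    simp only [map_smul, hx, TensorProduct.smul_tmul']

/-- `z₁ = q^{-1/2} (a c + ν b d) + 2 μ b c`. -/
def z₁ : Fun q :=
  (s⁻¹ : ℂ) • (a q * c q + (ν : ℂ) • (b q * d q)) + (2 * μ : ℂ) • (b q * c q)

/-- `z₂ = c² + ν d² + 2 μ q^{-1/2} c d`. -/
def z₂ : Fun q :=
  c q ^ 2 + (ν : ℂ) • d q ^ 2 + (2 * μ * s⁻¹ : ℂ) • (c q * d q)

/-- `z₃ = a² + ν b² + 2 μ q^{-1/2} a b`. -/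
def z₃ : Fun q :=
  a q ^ 2 + (ν : ℂ) • b q ^ 2 + (2 * μ * s⁻¹ : ℂ) • (a q * b q)

end SLq

end

/-! One inclusion is computational. The coproducts of `z₁`, `z₂`, `z₃` have second legs in the span
of `1`, `z₁`, `z₂`, `z₃`, and the quotient map sends the `zᵢ` to `0`, `ν • r 1` and `r 1`. Hence
each `zᵢ` is coinvariant. The coinvariants form an algebra because the quotient is by a right ideal,
so they contain `zAlgebra`.

For the converse, a functional `f` that kills the right ideal satisfies `act f x = f 1 • x` for
every coinvariant `x` (`act_of_mem_homogeneousSpace`). Two such functionals suffice. The character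
`oddChar` acts by `(-1)^N` in degree `N`, so coinvariants are even. The skew derivation `skewDer`
vanishes at `1`, so `act skewDer` annihilates coinvariants.

The algebra is filtered by degree in steps of two. The top symbol of an element of degree `N` is an
array indexed by `0 ≤ i, j ≤ N`, read off from a representation on functions on `ℤ³`. On symbols,
`act skewDer` is a three-term recurrence in `j` whose leading coefficient is nonzero because `q` is
not a root of unity (`coef_act_skewDer`). A symbol in the kernel is therefore determined by its
column `j = 0`. In degree `2n` that column has `2n + 1` entries, and products of the `zᵢ` realise
each of them separately (`exists_mem_zAlgebra_coef`). Subtracting a combination of such products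
lowers the degree by two, and induction on `n` finishes the proof. -/

set_option linter.unusedSimpArgs false
set_option linter.unnecessarySeqFocus false

noncomputable section

namespace SLq

/-! ### Relations, reality, images in the quotient and coproducts of the `zᵢ` -/

section relations

variable (q s : Circle) (μ ν : ℝ)

/-- The associated forms of the relations let `simp` reduce words of any length to the normal order
`b`, `c`, then powers of `a` alone or of `d` alone. Identities between words then become identities
of scalars. -/
theorem mul_ab_assoc (x : Fun q) : a q * (b q * x) = (q : ℂ) • (b q * (a q * x)) := by
  rw [← mul_assoc, rel_ab, smul_mul_assoc, mul_assoc]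

theorem mul_ac_assoc (x : Fun q) : a q * (c q * x) = (q : ℂ) • (c q * (a q * x)) := by
  rw [← mul_assoc, rel_ac, smul_mul_assoc, mul_assoc]

theorem mul_cb_assoc (x : Fun q) : c q * (b q * x) = b q * (c q * x) := by
  rw [← mul_assoc, ← rel_bc, mul_assoc]

theorem mul_db_assoc (x : Fun q) : d q * (b q * x) = (q : ℂ)⁻¹ • (b q * (d q * x)) := by
  rw [← mul_assoc, mul_db, smul_mul_assoc, mul_assoc]

theorem mul_dc_assoc (x : Fun q) : d q * (c q * x) = (q : ℂ)⁻¹ • (c q * (d q * x)) := by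
  rw [← mul_assoc, mul_dc, smul_mul_assoc, mul_assoc]

theorem mul_da_assoc (x : Fun q) :
    d q * (a q * x) = x + (q : ℂ)⁻¹ • (b q * (c q * x)) := by
  rw [← mul_assoc, mul_da, add_mul, one_mul, smul_mul_assoc, mul_assoc]

theorem mul_ad_assoc (x : Fun q) :
    a q * (d q * x) = x + (q : ℂ) • (b q * (c q * x)) := by
  rw [← mul_assoc, mul_ad, add_mul, one_mul, smul_mul_assoc, mul_assoc]

variable {q s} (hs : s ^ 2 = q)

include hs in
theorem coe_eq_sq : (q : ℂ) = (s : ℂ) ^ 2 := by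
  rw [← hs]; push_cast; rfl

theorem conj_coe (q : Circle) : (starRingEnd ℂ) (q : ℂ) = (q : ℂ)⁻¹ := by
  rw [← Circle.coe_inv_eq_conj, Circle.coe_inv]

include hs in
theorem z₁_mul_z₂ :
    z₁ q s μ ν * z₂ q s μ ν = ((q : ℂ) ^ 2) • (z₂ q s μ ν * z₁ q s μ ν) := by
  have hq := coe_eq_sq hs
  have h0 : (s : ℂ) ≠ 0 := s.coe_ne_zero
  simp only [z₁, z₂, pow_two (c q), pow_two (d q), mul_add, add_mul, smul_add, smul_mul_assoc,
    mul_smul_comm, mul_assoc, mul_one, rel_ab, rel_ac, ← rel_bc, mul_db, mul_dc, mul_da, mul_ad,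
    mul_ab_assoc, mul_ac_assoc, mul_cb_assoc, mul_db_assoc, mul_dc_assoc, mul_da_assoc,
    mul_ad_assoc, hq]
  match_scalars <;> field_simp

include hs in
theorem z₁_mul_z₃ :
    z₁ q s μ ν * z₃ q s μ ν = ((q : ℂ) ^ (-2 : ℤ)) • (z₃ q s μ ν * z₁ q s μ ν) := by
  have hq := coe_eq_sq hs
  have h0 : (s : ℂ) ≠ 0 := s.coe_ne_zero
  have h2 : (q : ℂ) ^ (-2 : ℤ) = ((q : ℂ)⁻¹) ^ 2 := by
    rw [zpow_neg, inv_pow]; rfl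
  simp only [h2, z₁, z₃, pow_two (a q), pow_two (b q), mul_add, add_mul, smul_add, smul_mul_assoc,
    mul_smul_comm, mul_assoc, mul_one, rel_ab, rel_ac, ← rel_bc, mul_db, mul_dc, mul_da, mul_ad,
    mul_ab_assoc, mul_ac_assoc, mul_cb_assoc, mul_db_assoc, mul_dc_assoc, mul_da_assoc,
    mul_ad_assoc, hq]
  match_scalars <;> field_simp

include hs in
theorem z₃_mul_z₂ :
    z₃ q s μ ν * z₂ q s μ ν
      = algebraMap ℂ (Fun q) (ν : ℂ) + ((q : ℂ) ^ 2) • z₁ q s μ ν ^ 2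
        + (2 * μ * q : ℂ) • z₁ q s μ ν := by
  have hq := coe_eq_sq hs
  have h0 : (s : ℂ) ≠ 0 := s.coe_ne_zero
  simp only [Algebra.algebraMap_eq_smul_one, z₁, z₂, z₃, pow_two (a q), pow_two (b q), pow_two (c q),
    pow_two (d q), pow_two (_ + _), mul_add, add_mul, smul_add, smul_mul_assoc,
    mul_smul_comm, mul_assoc, mul_one, rel_ab, rel_ac, ← rel_bc, mul_db, mul_dc, mul_da, mul_ad,
    mul_ab_assoc, mul_ac_assoc, mul_cb_assoc, mul_db_assoc, mul_dc_assoc, mul_da_assoc,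
    mul_ad_assoc, hq]
  match_scalars <;> field_simp

include hs in
theorem isSelfAdjoint_z₁ : IsSelfAdjoint (z₁ q s μ ν) := by
  have hq := coe_eq_sq hs
  have h0 : (s : ℂ) ≠ 0 := s.coe_ne_zero
  simp only [IsSelfAdjoint, z₁, star_add, star_smul, star_mul, star_gen, Complex.star_def,
    map_mul, map_inv₀, conj_coe, Complex.conj_ofReal, map_ofNat, mul_ca, mul_db, ← rel_bc, hq]
  match_scalars <;> field_simp

include hs in
theorem isSelfAdjoint_z₂ : IsSelfAdjoint (z₂ q s μ ν) := by
  have hq := coe_eq_sq hs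
  have h0 : (s : ℂ) ≠ 0 := s.coe_ne_zero
  simp only [IsSelfAdjoint, z₂, star_add, star_smul, star_mul, star_pow, star_gen,
    Complex.star_def, map_mul, map_inv₀, conj_coe, Complex.conj_ofReal, map_ofNat, mul_dc, hq]
  match_scalars <;> field_simp

include hs in
theorem isSelfAdjoint_z₃ : IsSelfAdjoint (z₃ q s μ ν) := by
  have hq := coe_eq_sq hs
  have h0 : (s : ℂ) ≠ 0 := s.coe_ne_zero
  simp only [IsSelfAdjoint, z₃, star_add, star_smul, star_mul, star_pow, star_gen,
    Complex.star_def, map_mul, map_inv₀, conj_coe, Complex.conj_ofReal, map_ofNat, mul_ba, hq]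
  match_scalars <;> field_simp

theorem mul_mem_rightIdeal {x : Fun q} (hx : x ∈ coideal q s μ ν) (y : Fun q) :
    x * y ∈ rightIdeal q s μ ν :=
  Submodule.mul_mem_mul hx Submodule.mem_top

theorem fst_mul_mem_rightIdeal (y : Fun q) :
    (a q - d q + (2 * s * μ : ℂ) • b q) * y ∈ rightIdeal q s μ ν :=
  mul_mem_rightIdeal μ ν (Submodule.subset_span (by simp)) y

theorem snd_mul_mem_rightIdeal (y : Fun q) :
    ((q * ν : ℂ) • b q + c q) * y ∈ rightIdeal q s μ ν :=
  mul_mem_rightIdeal μ ν (Submodule.subset_span (by simp)) y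

include hs in
theorem proj_z₁ : proj q s μ ν (z₁ q s μ ν) = 0 := by
  have hq := coe_eq_sq hs
  have h0 : (s : ℂ) ≠ 0 := s.coe_ne_zero
  refine (Submodule.Quotient.mk_eq_zero _).mpr ?_
  -- The term in `d c` from the first generator cancels the term in `c d` from the second.
  convert add_mem ((rightIdeal q s μ ν).smul_mem (s : ℂ)⁻¹ (fst_mul_mem_rightIdeal μ ν (c q)))
    ((rightIdeal q s μ ν).smul_mem ((s : ℂ)⁻¹ * (q : ℂ)⁻¹) (snd_mul_mem_rightIdeal μ ν (d q)))
    using 1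
  simp only [z₁, add_mul, sub_mul, smul_mul_assoc, mul_dc, hq]
  match_scalars <;> field_simp <;> ring

include hs in
theorem proj_z₂ : proj q s μ ν (z₂ q s μ ν) = (ν : ℂ) • proj q s μ ν 1 := by
  have hq := coe_eq_sq hs
  have h0 : (s : ℂ) ≠ 0 := s.coe_ne_zero
  rw [← map_smul]
  refine (Submodule.Quotient.eq _).mpr ?_
  -- The constant `ν` comes from `a d = 1 + q b c`; the terms in `b c` and in `b d` cancel, the
  -- latter because `s⁻¹ q = s`.
  convert add_mem (sub_mem (snd_mul_mem_rightIdeal μ ν (c q))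
    ((rightIdeal q s μ ν).smul_mem (ν : ℂ) (fst_mul_mem_rightIdeal μ ν (d q))))
    ((rightIdeal q s μ ν).smul_mem (2 * μ * (s : ℂ)⁻¹) (snd_mul_mem_rightIdeal μ ν (d q)))
    using 1
  simp only [z₂, add_mul, sub_mul, smul_mul_assoc, mul_ad, pow_two (c q), pow_two (d q), hq]
  match_scalars <;> field_simp <;> ring

include hs in
theorem proj_z₃ : proj q s μ ν (z₃ q s μ ν) = proj q s μ ν 1 := by
  have hq := coe_eq_sq hs
  have h0 : (s : ℂ) ≠ 0 := s.coe_ne_zero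
  refine (Submodule.Quotient.eq _).mpr ?_
  convert add_mem (fst_mul_mem_rightIdeal μ ν (a q))
    ((rightIdeal q s μ ν).smul_mem ((q : ℂ)⁻¹) (snd_mul_mem_rightIdeal μ ν (b q)))
    using 1
  simp only [z₃, add_mul, sub_mul, smul_mul_assoc, mul_da, mul_ba, ← rel_bc, pow_two (a q),
    pow_two (b q), hq]
  match_scalars <;> field_simp <;> ring

theorem comul_gen (g : Gen) : Coalgebra.comul (R := ℂ) (gen q g) = comulGen q g :=
  comulHom_gen q g

include hs in
-- `z₃` and `z₂` are the same quadratic form evaluated on the rows `(a, b)` and `(c, d)`, and `z₁`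
-- is its mixed version. As `Δ` replaces each row by a combination of both rows, the second legs
-- stay in the span of these forms and `1`.
theorem comul_z₃ : Coalgebra.comul (R := ℂ) (z₃ q s μ ν) =
    (a q * a q) ⊗ₜ[ℂ] z₃ q s μ ν + (b q * b q) ⊗ₜ[ℂ] z₂ q s μ ν
      + (a q * b q) ⊗ₜ[ℂ] (((1 + (q : ℂ)⁻¹ ^ 2) * s) • z₁ q s μ ν + (2 * μ * (s : ℂ)⁻¹) • 1) := by
  have hq := coe_eq_sq hs
  have h0 : (s : ℂ) ≠ 0 := s.coe_ne_zero
  simp only [z₁, z₂, z₃, map_add, map_smul, Bialgebra.comul_mul, Bialgebra.comul_pow, comul_gen,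
    comulGen, pow_two (a q), pow_two (b q), pow_two (c q), pow_two (d q), pow_two (_ + _),
    mul_add, add_mul, smul_add, Algebra.TensorProduct.tmul_mul_tmul, mul_ba,
    rel_ac, mul_db, mul_dc, mul_da, mul_ad, ← rel_bc, TensorProduct.tmul_add,
    TensorProduct.tmul_smul, ← TensorProduct.smul_tmul', hq]
  match_scalars <;> field_simp <;> ring

include hs in
theorem comul_z₂ : Coalgebra.comul (R := ℂ) (z₂ q s μ ν) =
    (c q * c q) ⊗ₜ[ℂ] z₃ q s μ ν + (d q * d q) ⊗ₜ[ℂ] z₂ q s μ ν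
      + (c q * d q) ⊗ₜ[ℂ] (((1 + (q : ℂ)⁻¹ ^ 2) * s) • z₁ q s μ ν + (2 * μ * (s : ℂ)⁻¹) • 1) := by
  have hq := coe_eq_sq hs
  have h0 : (s : ℂ) ≠ 0 := s.coe_ne_zero
  simp only [z₁, z₂, z₃, map_add, map_smul, Bialgebra.comul_mul, Bialgebra.comul_pow, comul_gen,
    comulGen, pow_two (a q), pow_two (b q), pow_two (c q), pow_two (d q), pow_two (_ + _),
    mul_add, add_mul, smul_add, Algebra.TensorProduct.tmul_mul_tmul, mul_ba,
    rel_ac, mul_db, mul_dc, mul_da, mul_ad, ← rel_bc, TensorProduct.tmul_add,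
    TensorProduct.tmul_smul, ← TensorProduct.smul_tmul', hq]
  match_scalars <;> field_simp <;> ring

include hs in
theorem comul_z₁ : Coalgebra.comul (R := ℂ) (z₁ q s μ ν) =
    ((s : ℂ)⁻¹ • (a q * c q)) ⊗ₜ[ℂ] z₃ q s μ ν + ((s : ℂ)⁻¹ • (b q * d q)) ⊗ₜ[ℂ] z₂ q s μ ν
      + (1 : Fun q) ⊗ₜ[ℂ] z₁ q s μ ν + (b q * c q) ⊗ₜ[ℂ]
        (((q : ℂ) + (q : ℂ)⁻¹) • z₁ q s μ ν + (2 * μ : ℂ) • 1) := by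
  have hq := coe_eq_sq hs
  have h0 : (s : ℂ) ≠ 0 := s.coe_ne_zero
  simp only [z₁, z₂, z₃, map_add, map_smul, Bialgebra.comul_mul, Bialgebra.comul_pow, comul_gen,
    comulGen, pow_two (a q), pow_two (b q), pow_two (c q), pow_two (d q), pow_two (_ + _),
    mul_add, add_mul, smul_add, Algebra.TensorProduct.tmul_mul_tmul, mul_ba,
    rel_ac, mul_db, mul_dc, mul_da, mul_ad, ← rel_bc, TensorProduct.tmul_add,
    TensorProduct.tmul_smul, ← TensorProduct.smul_tmul', TensorProduct.add_tmul, hq]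
  match_scalars <;> field_simp <;> ring

end relations

/-! ### Algebra and comodule structure of the coinvariants; contraction with functionals -/

section coinvariants

variable {q s : Circle} (μ ν : ℝ)

/-- The right action of the function algebra on its quotient by the right ideal. -/
def subgpMulRight (y : Fun q) : Subgp q s μ ν →ₗ[ℂ] Subgp q s μ ν :=
  (rightIdeal q s μ ν).mapQ (rightIdeal q s μ ν) (LinearMap.mulRight ℂ y) (by
    refine Submodule.mul_le.mpr fun m hm n _ => ?_
    simpa [mul_assoc] using mul_mem_rightIdeal μ ν hm (n * y))

theorem subgpMulRight_proj (x y : Fun q) :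
    subgpMulRight μ ν y (proj q s μ ν x) = proj q s μ ν (x * y) := rfl

theorem mem_homogeneousSpace {x : Fun q} : x ∈ homogeneousSpace q s μ ν ↔
    (proj q s μ ν).lTensor (Fun q) (Coalgebra.comul (R := ℂ) x) = x ⊗ₜ[ℂ] proj q s μ ν 1 :=
  Iff.rfl

theorem one_mem_homogeneousSpace : (1 : Fun q) ∈ homogeneousSpace q s μ ν := by
  rw [mem_homogeneousSpace, Bialgebra.comul_one, Algebra.TensorProduct.one_def,
    LinearMap.lTensor_tmul]

theorem lTensor_proj_mul (t : Fun q ⊗[ℂ] Fun q) (y z : Fun q) :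
    (proj q s μ ν).lTensor (Fun q) (t * (y ⊗ₜ z)) =
      TensorProduct.map (LinearMap.mulRight ℂ y) (subgpMulRight μ ν z)
        ((proj q s μ ν).lTensor (Fun q) t) := by
  induction t with
  | zero => simp
  | add t u ht hu => simp only [add_mul, map_add, ht, hu]
  | tmul x w => simp [subgpMulRight_proj]

theorem mul_mem_homogeneousSpace {x y : Fun q} (hx : x ∈ homogeneousSpace q s μ ν)
    (hy : y ∈ homogeneousSpace q s μ ν) : x * y ∈ homogeneousSpace q s μ ν := by
  rw [mem_homogeneousSpace] at *
  -- The quotient map is right linear, so coinvariance of `x` survives right multiplication: `x₁ y ⊗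
  -- r (x₂ z) = x y ⊗ r z`.
  have key (t : Fun q ⊗[ℂ] Fun q) :
      (proj q s μ ν).lTensor (Fun q) (Coalgebra.comul (R := ℂ) x * t) =
        (LinearMap.mulLeft ℂ x).rTensor _ ((proj q s μ ν).lTensor (Fun q) t) := by
    induction t with
    | zero => simp
    | add t u ht hu => simp only [mul_add, map_add, ht, hu]
    | tmul y z => simp [lTensor_proj_mul, hx, subgpMulRight_proj]
  rw [Bialgebra.comul_mul, key, hy]
  simp

/-- The coinvariants, as a subalgebra. -/
def homogeneousSubalgebra : Subalgebra ℂ (Fun q) :=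
  (homogeneousSpace q s μ ν).toSubalgebra (one_mem_homogeneousSpace μ ν)
    fun _ _ => mul_mem_homogeneousSpace μ ν

variable (hs : s ^ 2 = q)

include hs in
theorem z₁_mem_homogeneousSpace : z₁ q s μ ν ∈ homogeneousSpace q s μ ν := by
  rw [mem_homogeneousSpace, comul_z₁ μ ν hs]
  simp only [map_add, LinearMap.lTensor_tmul, map_smul, proj_z₁ μ ν hs, proj_z₂ μ ν hs,
    proj_z₃ μ ν hs]
  simp only [z₁, Circle.coe_inv, TensorProduct.add_tmul, TensorProduct.tmul_smul,
    ← TensorProduct.smul_tmul', smul_zero, TensorProduct.tmul_zero, zero_add, add_zero, smul_add]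
  module

include hs in
theorem z₂_mem_homogeneousSpace : z₂ q s μ ν ∈ homogeneousSpace q s μ ν := by
  rw [mem_homogeneousSpace, comul_z₂ μ ν hs]
  simp only [map_add, LinearMap.lTensor_tmul, map_smul, proj_z₁ μ ν hs, proj_z₂ μ ν hs,
    proj_z₃ μ ν hs]
  simp only [z₂, pow_two (c q), pow_two (d q), Circle.coe_inv, TensorProduct.add_tmul, TensorProduct.tmul_smul,
    ← TensorProduct.smul_tmul', smul_zero, TensorProduct.tmul_zero, zero_add, add_zero, smul_add]

include hs in
theorem z₃_mem_homogeneousSpace : z₃ q s μ ν ∈ homogeneousSpace q s μ ν := by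
  rw [mem_homogeneousSpace, comul_z₃ μ ν hs]
  simp only [map_add, LinearMap.lTensor_tmul, map_smul, proj_z₁ μ ν hs, proj_z₂ μ ν hs,
    proj_z₃ μ ν hs]
  simp only [z₃, pow_two (a q), pow_two (b q), Circle.coe_inv, TensorProduct.add_tmul, TensorProduct.tmul_smul,
    ← TensorProduct.smul_tmul', smul_zero, TensorProduct.tmul_zero, zero_add, add_zero, smul_add]

variable (q s) in
/-- The subalgebra generated by `z₁, z₂, z₃`. -/
abbrev zAlgebra : Subalgebra ℂ (Fun q) :=
  Algebra.adjoin ℂ {z₁ q s μ ν, z₂ q s μ ν, z₃ q s μ ν}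

theorem z₁_mem_zAlgebra : z₁ q s μ ν ∈ zAlgebra q s μ ν := Algebra.subset_adjoin (by simp)
theorem z₂_mem_zAlgebra : z₂ q s μ ν ∈ zAlgebra q s μ ν := Algebra.subset_adjoin (by simp)
theorem z₃_mem_zAlgebra : z₃ q s μ ν ∈ zAlgebra q s μ ν := Algebra.subset_adjoin (by simp)

include hs in
theorem zAlgebra_le_homogeneousSpace :
    (zAlgebra q s μ ν).toSubmodule ≤ homogeneousSpace q s μ ν := by
  change zAlgebra q s μ ν ≤ homogeneousSubalgebra μ ν
  refine Algebra.adjoin_le ?_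
  rintro x (rfl | rfl | rfl)
  · exact z₁_mem_homogeneousSpace μ ν hs
  · exact z₂_mem_homogeneousSpace μ ν hs
  · exact z₃_mem_homogeneousSpace μ ν hs

include hs in
theorem comul_mem_of_mem_zAlgebra {x : Fun q} (hx : x ∈ zAlgebra q s μ ν) :
    Coalgebra.comul (R := ℂ) x ∈
      LinearMap.range ((zAlgebra q s μ ν).toSubmodule.subtype.lTensor (Fun q)) := by
  -- Seen as the range of an algebra homomorphism, the target is a subalgebra, so only the three
  -- generators need checking.
  let T : Subalgebra ℂ (Fun q ⊗[ℂ] Fun q) :=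
    (Algebra.TensorProduct.map (AlgHom.id ℂ (Fun q)) (zAlgebra q s μ ν).val).range
  have hT (y : Fun q) {z : Fun q} (hz : z ∈ zAlgebra q s μ ν) : y ⊗ₜ[ℂ] z ∈ T :=
    ⟨y ⊗ₜ ⟨z, hz⟩, by simp⟩
  have hle : zAlgebra q s μ ν ≤ T.comap (Bialgebra.comulAlgHom ℂ (Fun q)) := by
    have h₁ := z₁_mem_zAlgebra (q := q) (s := s) μ ν
    have h₂ := z₂_mem_zAlgebra (q := q) (s := s) μ ν
    have h₃ := z₃_mem_zAlgebra (q := q) (s := s) μ ν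
    have h (u v : ℂ) : u • z₁ q s μ ν + v • 1 ∈ zAlgebra q s μ ν :=
      add_mem (Subalgebra.smul_mem _ h₁ u) (Subalgebra.smul_mem _ (one_mem _) v)
    refine Algebra.adjoin_le ?_
    rintro x (rfl | rfl | rfl) <;>
      simp only [Subalgebra.coe_comap, Set.mem_preimage, Bialgebra.comulAlgHom_apply,
        SetLike.mem_coe]
    · rw [comul_z₁ μ ν hs]
      exact add_mem (add_mem (add_mem (hT _ h₃) (hT _ h₂)) (hT _ h₁)) (hT _ (h _ _))
    · rw [comul_z₂ μ ν hs]
      exact add_mem (add_mem (hT _ h₃) (hT _ h₂)) (hT _ (h _ _))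
    · rw [comul_z₃ μ ν hs]
      exact add_mem (add_mem (hT _ h₃) (hT _ h₂)) (hT _ (h _ _))
  exact hle hx

/-- Contraction of the second leg of the coproduct with a linear functional. -/
def act (f : Fun q →ₗ[ℂ] ℂ) : Fun q →ₗ[ℂ] Fun q :=
  (TensorProduct.rid ℂ (Fun q)).toLinearMap ∘ₗ f.lTensor (Fun q) ∘ₗ
    Coalgebra.comul (R := ℂ)

/-- Such an `f` factors through the quotient map, so contracting the coinvariance equation with the
induced functional gives the claim. -/
theorem act_of_mem_homogeneousSpace {f : Fun q →ₗ[ℂ] ℂ}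
    (h₁ : ∀ x, f ((a q - d q + (2 * s * μ : ℂ) • b q) * x) = 0)
    (h₂ : ∀ x, f (((q * ν : ℂ) • b q + c q) * x) = 0)
    {x : Fun q} (hx : x ∈ homogeneousSpace q s μ ν) : act f x = f 1 • x := by
  have hf : rightIdeal q s μ ν ≤ LinearMap.ker f := by
    refine Submodule.mul_le.mpr fun m hm n _ => ?_
    have : coideal q s μ ν ≤ LinearMap.ker (f ∘ₗ LinearMap.mulRight ℂ n) := by
      refine Submodule.span_le.mpr ?_
      rintro y (rfl | rfl)
      · simpa using h₁ n
      · simpa using h₂ n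
    exact this hm
  have h : f = (rightIdeal q s μ ν).liftQ f hf ∘ₗ proj q s μ ν :=
    ((rightIdeal q s μ ν).liftQ_mkQ f hf).symm
  rw [act, h]
  simp only [LinearMap.lTensor_comp, LinearMap.comp_apply, LinearEquiv.coe_coe]
  rw [(mem_homogeneousSpace μ ν).mp hx]
  simp

theorem act_one (f : Fun q →ₗ[ℂ] ℂ) : act f 1 = f 1 • 1 := by
  simp [act, Algebra.TensorProduct.one_def]

theorem contract_mul (f : Fun q →ₗ[ℂ] ℂ) (p r : Fun q) (t : Fun q ⊗[ℂ] Fun q) :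
    TensorProduct.rid ℂ (Fun q) (f.lTensor (Fun q) ((p ⊗ₜ r) * t)) =
      p * TensorProduct.rid ℂ (Fun q) ((f ∘ₗ LinearMap.mulLeft ℂ r).lTensor (Fun q) t) := by
  induction t with
  | zero => simp
  | add t u ht hu => simp only [mul_add, map_add, ht, hu]
  | tmul y z => simp

theorem act_a_mul (f : Fun q →ₗ[ℂ] ℂ) (x : Fun q) : act f (a q * x) =
    a q * act (f ∘ₗ LinearMap.mulLeft ℂ (a q)) x +
      b q * act (f ∘ₗ LinearMap.mulLeft ℂ (c q)) x := by
  simp [act, comul_gen, comulGen, add_mul, contract_mul]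

theorem act_b_mul (f : Fun q →ₗ[ℂ] ℂ) (x : Fun q) : act f (b q * x) =
    a q * act (f ∘ₗ LinearMap.mulLeft ℂ (b q)) x +
      b q * act (f ∘ₗ LinearMap.mulLeft ℂ (d q)) x := by
  simp [act, comul_gen, comulGen, add_mul, contract_mul]

theorem act_c_mul (f : Fun q →ₗ[ℂ] ℂ) (x : Fun q) : act f (c q * x) =
    c q * act (f ∘ₗ LinearMap.mulLeft ℂ (a q)) x +
      d q * act (f ∘ₗ LinearMap.mulLeft ℂ (c q)) x := by
  simp [act, comul_gen, comulGen, add_mul, contract_mul]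

theorem act_d_mul (f : Fun q →ₗ[ℂ] ℂ) (x : Fun q) : act f (d q * x) =
    c q * act (f ∘ₗ LinearMap.mulLeft ℂ (b q)) x +
      d q * act (f ∘ₗ LinearMap.mulLeft ℂ (d q)) x := by
  simp [act, comul_gen, comulGen, add_mul, contract_mul]

theorem act_add (f g : Fun q →ₗ[ℂ] ℂ) (x : Fun q) : act (f + g) x = act f x + act g x := by
  simp [act, LinearMap.lTensor_add]

theorem act_smul (z : ℂ) (f : Fun q →ₗ[ℂ] ℂ) (x : Fun q) : act (z • f) x = z • act f x := by
  simp [act, LinearMap.lTensor_smul]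

theorem act_neg (f : Fun q →ₗ[ℂ] ℂ) (x : Fun q) : act (-f) x = -act f x := by
  rw [← neg_one_smul ℂ f, act_smul, neg_one_smul]

theorem act_zero (x : Fun q) : act (0 : Fun q →ₗ[ℂ] ℂ) x = 0 := by
  simp [act, LinearMap.lTensor_zero]

end coinvariants

/-! ### A representation on functions on `ℤ³` and coefficients -/

section representation

variable (q : Circle)

/-- The operators by which the generators act on functions on `ℤ³`. -/
def opGen : Gen → Module.End ℂ (ℤ → ℤ → ℤ → ℂ)
  | .a =>
    { toFun f N i j := f (N - 1) i j
      map_add' _ _ := rfl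
      map_smul' _ _ := rfl }
  | .b =>
    { toFun f N i j := (q : ℂ) ^ (j - N) * f (N - 1) i (j - 1)
      map_add' _ _ := by funext; simp [mul_add]
      map_smul' _ _ := by funext; simp [mul_left_comm] }
  | .c =>
    { toFun f N i j := (q : ℂ) ^ (i - N) * f (N - 1) (i - 1) j
      map_add' _ _ := by funext; simp [mul_add]
      map_smul' _ _ := by funext; simp [mul_left_comm] }
  | .d =>
    { toFun f N i j := (q : ℂ) ^ (i + j - 2 * N) * f (N - 1) (i - 1) (j - 1) + f (N + 1) i j
      map_add' _ _ := by funext; simp [mul_add]; ring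
      map_smul' _ _ := by funext; simp [mul_add, mul_left_comm] }

/-- A representation of the function algebra on functions on `ℤ³`, obtained by letting
`a, b, c, d` act on a tensor product of two quantum tori as
`x ⊗ u, x ⊗ v, y ⊗ u, y ⊗ v + x⁻¹ ⊗ u⁻¹`. -/
def rep : Fun q →ₐ[ℂ] Module.End ℂ (ℤ → ℤ → ℤ → ℂ) := by
  have hq : (q : ℂ) ≠ 0 := q.coe_ne_zero
  refine lift (opGen q) ?_ ?_ ?_ ?_ ?_ ?_ ?_ <;>
  · refine LinearMap.ext fun f => ?_
    funext N i j
    simp only [opGen, Module.End.mul_apply, LinearMap.smul_apply, LinearMap.sub_apply,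
      LinearMap.coe_mk, AddHom.coe_mk, Pi.smul_apply, Pi.sub_apply, smul_eq_mul,
      Module.End.one_apply, add_sub_cancel_right, sub_add_cancel, mul_sub, mul_add, mul_one,
      zpow_sub₀ hq, zpow_add₀ hq, two_mul, zpow_one]
    field_simp
    try ring

/-- The indicator function of the origin. -/
def originVec : ℤ → ℤ → ℤ → ℂ := fun N i j => if N = 0 ∧ i = 0 ∧ j = 0 then 1 else 0

/-- The coefficients of an element of the function algebra. -/
def coef : Fun q →ₗ[ℂ] (ℤ → ℤ → ℤ → ℂ) where
  toFun x := rep q x originVec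
  map_add' x y := by simp
  map_smul' z x := by simp

variable {q}

theorem coef_one : coef q 1 = originVec := by simp [coef]

theorem coef_gen_mul (g : Gen) (x : Fun q) : coef q (gen q g * x) = opGen q g (coef q x) := by
  simp [coef, rep]

/-- In the coefficients, `N` is the degree, `i` counts factors from the lower row `c, d`, and `j`
counts factors from the right column `b, d`. The second summand of `d`, which makes the determinant
relations hold, lowers `N` by one and keeps `i` and `j`. -/
theorem coef_a_mul (x : Fun q) (N i j : ℤ) :
    coef q (a q * x) N i j = coef q x (N - 1) i j := by
  rw [a, coef_gen_mul]; rfl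

theorem coef_b_mul (x : Fun q) (N i j : ℤ) :
    coef q (b q * x) N i j = (q : ℂ) ^ (j - N) * coef q x (N - 1) i (j - 1) := by
  rw [b, coef_gen_mul]; rfl

theorem coef_c_mul (x : Fun q) (N i j : ℤ) :
    coef q (c q * x) N i j = (q : ℂ) ^ (i - N) * coef q x (N - 1) (i - 1) j := by
  rw [c, coef_gen_mul]; rfl

theorem coef_d_mul (x : Fun q) (N i j : ℤ) :
    coef q (d q * x) N i j = (q : ℂ) ^ (i + j - 2 * N) * coef q x (N - 1) (i - 1) (j - 1)
      + coef q x (N + 1) i j := by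
  rw [d, coef_gen_mul]; rfl

theorem mem_of_stable (S : Submodule ℂ (Fun q)) (one : 1 ∈ S)
    (mul : ∀ g, ∀ x ∈ S, gen q g * x ∈ S) (x : Fun q) : x ∈ S := by
  -- The left stabiliser of `S` is a subalgebra containing the generators, hence everything;
  -- applying it to `1 ∈ S` gives the claim.
  let T : Subalgebra ℂ (Fun q) :=
    { carrier := {y | ∀ x ∈ S, y * x ∈ S}
      mul_mem' := fun {y z} hy hz x hx => by rw [mul_assoc]; exact hy _ (hz _ hx)
      add_mem' := fun {y z} hy hz x hx => by rw [add_mul]; exact add_mem (hy _ hx) (hz _ hx)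
      algebraMap_mem' := fun r x hx => by
        rw [← Algebra.smul_def]; exact S.smul_mem r hx }
  let f : Fun q →ₐ[ℂ] T := lift (fun g => ⟨gen q g, mul g⟩)
    (Subtype.ext (rel_ab q)) (Subtype.ext (rel_ac q)) (Subtype.ext (rel_bc q))
    (Subtype.ext (rel_bd q)) (Subtype.ext (rel_cd q)) (Subtype.ext (rel_da q))
    (Subtype.ext (rel_ad q))
  have h : T.val.comp f = AlgHom.id ℂ (Fun q) := hom_ext fun g => by simp [f]
  have hx : T.val (f x) = x := DFunLike.congr_fun h x
  have := (f x).2 1 one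
  rw [mul_one] at this
  rwa [← hx]

/-- No generator lowers `j`. This is the boundary condition for the recurrence in `j`. -/
theorem coef_of_neg (x : Fun q) {j : ℤ} (hj : j < 0) (N i : ℤ) : coef q x N i j = 0 := by
  let S : Submodule ℂ (Fun q) :=
    { carrier := {x | ∀ N i j : ℤ, j < 0 → coef q x N i j = 0}
      zero_mem' := by simp
      add_mem' := fun {x y} hx hy N i j hj => by simp [hx N i j hj, hy N i j hj]
      smul_mem' := fun z x hx N i j hj => by simp [hx N i j hj] }
  refine mem_of_stable S ?_ ?_ x N i j hj
  · intro N i j hj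
    rw [coef_one, originVec, if_neg (by omega)]
  · intro g x hx N i j hj
    cases g
    · rw [coef_a_mul, hx _ _ _ hj]
    · rw [coef_b_mul, hx _ _ _ (by omega), mul_zero]
    · rw [coef_c_mul, hx _ _ _ hj, mul_zero]
    · rw [coef_d_mul, hx _ _ _ (by omega), hx _ _ _ hj, mul_zero, zero_add]

end representation

/-! ### The degree filtration and normally ordered monomials -/

section filtration

variable (q : Circle)

/-- The normally ordered monomials of degree `N`. -/
def normalMonomial (N i j : ℕ) : Fun q :=
  b q ^ min j (N - i) * (c q ^ min i (N - j) * (a q ^ (N - i - j) * d q ^ (i + j - N)))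

/-- The span of the normally ordered monomials of degree `N`. -/
def homogeneousPart (N : ℕ) : Submodule ℂ (Fun q) :=
  Submodule.span ℂ (Set.range fun k : Fin (N + 1) × Fin (N + 1) => normalMonomial q N k.1 k.2)

/-- The filtration of the function algebra by the degree, within a fixed parity. -/
def filt : ℕ → Submodule ℂ (Fun q)
  | 0 => homogeneousPart q 0
  | 1 => homogeneousPart q 1
  | N + 2 => filt N ⊔ homogeneousPart q (N + 2)

variable {q}

theorem homogeneousPart_le_filt : ∀ N : ℕ, homogeneousPart q N ≤ filt q N
  | 0 => le_rfl
  | 1 => le_rfl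
  | _ + 2 => le_sup_right

theorem filt_le (N : ℕ) : filt q N ≤ filt q (N + 2) := le_sup_left

theorem normalMonomial_mem {N i j : ℕ} (hi : i ≤ N) (hj : j ≤ N) :
    normalMonomial q N i j ∈ homogeneousPart q N :=
  Submodule.subset_span ⟨(⟨i, by omega⟩, ⟨j, by omega⟩), rfl⟩

/-- Truncated subtraction leaves at most one of `a` and `d` in a monomial: `a` when `i + j ≤ N`, `d`
otherwise. Every pair `i, j ≤ N` thus names one monomial. -/
theorem normalMonomial_a (r t p : ℕ) :
    normalMonomial q (r + t + p) t r = b q ^ r * (c q ^ t * a q ^ p) := by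
  have h₁ : min r (r + t + p - t) = r := by omega
  have h₂ : min t (r + t + p - r) = t := by omega
  have h₃ : r + t + p - t - r = p := by omega
  have h₄ : t + r - (r + t + p) = 0 := by omega
  rw [normalMonomial, h₁, h₂, h₃, h₄, pow_zero, mul_one]

theorem normalMonomial_d (r t p : ℕ) :
    normalMonomial q (r + t + p) (t + p) (r + p) = b q ^ r * (c q ^ t * d q ^ p) := by
  have h₁ : min (r + p) (r + t + p - (t + p)) = r := by omega
  have h₂ : min (t + p) (r + t + p - (r + p)) = t := by omega
  have h₃ : r + t + p - (t + p) - (r + p) = 0 := by omega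
  have h₄ : (t + p) + (r + p) - (r + t + p) = p := by omega
  rw [normalMonomial, h₁, h₂, h₃, h₄, pow_zero, one_mul]

theorem pow_a_mem (r t p : ℕ) : b q ^ r * (c q ^ t * a q ^ p) ∈ filt q (r + t + p) := by
  rw [← normalMonomial_a]
  exact homogeneousPart_le_filt _ (normalMonomial_mem (by omega) (by omega))

theorem pow_d_mem (r t p : ℕ) : b q ^ r * (c q ^ t * d q ^ p) ∈ filt q (r + t + p) := by
  rw [← normalMonomial_d]
  exact homogeneousPart_le_filt _ (normalMonomial_mem (by omega) (by omega))

theorem homogeneousPart_induction {N : ℕ} {S : Submodule ℂ (Fun q)}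
    (ha : ∀ r t p, r + t + p = N → b q ^ r * (c q ^ t * a q ^ p) ∈ S)
    (hd : ∀ r t p, r + t + p = N → b q ^ r * (c q ^ t * d q ^ p) ∈ S) :
    homogeneousPart q N ≤ S := by
  refine Submodule.span_le.mpr ?_
  rintro _ ⟨⟨⟨i, hi⟩, ⟨j, hj⟩⟩, rfl⟩
  change normalMonomial q N i j ∈ S
  by_cases h : i + j ≤ N
  · obtain ⟨p, rfl⟩ : ∃ p, N = j + i + p := ⟨N - i - j, by omega⟩
    rw [normalMonomial_a]
    exact ha _ _ _ rfl
  · obtain ⟨p, r, t, rfl, rfl, rfl⟩ : ∃ p r t, N = r + t + p ∧ i = t + p ∧ j = r + p :=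
      ⟨i + j - N, N - i, N - j, by omega, by omega, by omega⟩
    rw [normalMonomial_d]
    exact hd _ _ _ rfl

theorem a_mul_pow_b (r : ℕ) (x : Fun q) :
    a q * (b q ^ r * x) = (q : ℂ) ^ r • (b q ^ r * (a q * x)) := by
  induction r generalizing x with
  | zero => simp
  | succ r ih => rw [pow_succ, mul_assoc, ih, mul_ab_assoc, mul_smul_comm, smul_smul, mul_assoc,
      pow_succ]

theorem a_mul_pow_c (r : ℕ) (x : Fun q) :
    a q * (c q ^ r * x) = (q : ℂ) ^ r • (c q ^ r * (a q * x)) := by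
  induction r generalizing x with
  | zero => simp
  | succ r ih => rw [pow_succ, mul_assoc, ih, mul_ac_assoc, mul_smul_comm, smul_smul, mul_assoc,
      pow_succ]

theorem d_mul_pow_b (r : ℕ) (x : Fun q) :
    d q * (b q ^ r * x) = ((q : ℂ)⁻¹) ^ r • (b q ^ r * (d q * x)) := by
  induction r generalizing x with
  | zero => simp
  | succ r ih => rw [pow_succ, mul_assoc, ih, mul_db_assoc, mul_smul_comm, smul_smul, mul_assoc,
      pow_succ]

theorem d_mul_pow_c (r : ℕ) (x : Fun q) :
    d q * (c q ^ r * x) = ((q : ℂ)⁻¹) ^ r • (c q ^ r * (d q * x)) := by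
  induction r generalizing x with
  | zero => simp
  | succ r ih => rw [pow_succ, mul_assoc, ih, mul_dc_assoc, mul_smul_comm, smul_smul, mul_assoc,
      pow_succ]

theorem c_mul_pow_b (r : ℕ) (x : Fun q) : c q * (b q ^ r * x) = b q ^ r * (c q * x) := by
  have : Commute (c q) (b q ^ r) := Commute.pow_right (rel_bc q).symm r
  rw [← mul_assoc, this.eq, mul_assoc]

theorem b_mul_pow_c (r : ℕ) (x : Fun q) : c q ^ r * (b q * x) = b q * (c q ^ r * x) := by
  have : Commute (c q ^ r) (b q) := Commute.pow_left (rel_bc q).symm r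
  rw [← mul_assoc, this.eq, mul_assoc]

/-- The only product that changes degree unevenly is `d a = 1 + q⁻¹ b c`. Its constant term drops
the degree by two, so parity is preserved and the filtration may proceed in steps of two. -/
theorem gen_mul_pow_a_mem (g : Gen) (r t p : ℕ) :
    gen q g * (b q ^ r * (c q ^ t * a q ^ p)) ∈ filt q (r + t + p + 1) := by
  cases g
  · change a q * _ ∈ _
    rw [a_mul_pow_b, a_mul_pow_c, ← pow_succ', mul_smul_comm]
    exact Submodule.smul_mem _ _ (Submodule.smul_mem _ _ (pow_a_mem r t (p + 1)))
  · change b q * _ ∈ _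
    rw [← mul_assoc, ← pow_succ', show r + t + p + 1 = (r + 1) + t + p by omega]
    exact pow_a_mem (r + 1) t p
  · change c q * _ ∈ _
    rw [c_mul_pow_b, ← mul_assoc (c q), ← pow_succ', show r + t + p + 1 = r + (t + 1) + p by omega]
    exact pow_a_mem r (t + 1) p
  · change d q * _ ∈ _
    rw [d_mul_pow_b, d_mul_pow_c, mul_smul_comm]
    refine Submodule.smul_mem _ _ (Submodule.smul_mem _ _ ?_)
    cases p with
    | zero => simpa using pow_d_mem r t 1
    | succ p =>
      rw [pow_succ', mul_da_assoc, mul_add, mul_add, mul_smul_comm, mul_smul_comm, b_mul_pow_c,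
        ← mul_assoc (c q ^ t) (c q), ← mul_assoc (b q ^ r) (b q), ← pow_succ, ← pow_succ]
      refine add_mem (filt_le _ (pow_a_mem r t p)) (Submodule.smul_mem _ _ ?_)
      rw [show r + t + (p + 1) + 1 = (r + 1) + (t + 1) + p by omega]
      exact pow_a_mem (r + 1) (t + 1) p

theorem gen_mul_pow_d_mem (g : Gen) (r t p : ℕ) :
    gen q g * (b q ^ r * (c q ^ t * d q ^ p)) ∈ filt q (r + t + p + 1) := by
  cases g
  · change a q * _ ∈ _
    rw [a_mul_pow_b, a_mul_pow_c, mul_smul_comm]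
    refine Submodule.smul_mem _ _ (Submodule.smul_mem _ _ ?_)
    cases p with
    | zero => simpa using pow_a_mem r t 1
    | succ p =>
      rw [pow_succ', mul_ad_assoc, mul_add, mul_add, mul_smul_comm, mul_smul_comm, b_mul_pow_c,
        ← mul_assoc (c q ^ t) (c q), ← mul_assoc (b q ^ r) (b q), ← pow_succ, ← pow_succ]
      refine add_mem (filt_le _ (pow_d_mem r t p)) (Submodule.smul_mem _ _ ?_)
      rw [show r + t + (p + 1) + 1 = (r + 1) + (t + 1) + p by omega]
      exact pow_d_mem (r + 1) (t + 1) p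
  · change b q * _ ∈ _
    rw [← mul_assoc, ← pow_succ', show r + t + p + 1 = (r + 1) + t + p by omega]
    exact pow_d_mem (r + 1) t p
  · change c q * _ ∈ _
    rw [c_mul_pow_b, ← mul_assoc (c q), ← pow_succ', show r + t + p + 1 = r + (t + 1) + p by omega]
    exact pow_d_mem r (t + 1) p
  · change d q * _ ∈ _
    rw [d_mul_pow_b, d_mul_pow_c, ← pow_succ', mul_smul_comm]
    exact Submodule.smul_mem _ _ (Submodule.smul_mem _ _ (pow_d_mem r t (p + 1)))

theorem gen_mul_mem_filt (g : Gen) : ∀ {N : ℕ} {x : Fun q}, x ∈ filt q N →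
    gen q g * x ∈ filt q (N + 1) := by
  have key (N : ℕ) : homogeneousPart q N ≤
      (filt q (N + 1)).comap (LinearMap.mulLeft ℂ (gen q g)) :=
    homogeneousPart_induction (by rintro r t p rfl; exact gen_mul_pow_a_mem g r t p)
      (by rintro r t p rfl; exact gen_mul_pow_d_mem g r t p)
  have main : ∀ N : ℕ, filt q N ≤ (filt q (N + 1)).comap (LinearMap.mulLeft ℂ (gen q g)) := by
    intro N
    induction N using Nat.twoStepInduction with
    | zero => exact key 0
    | one => exact key 1
    | more N ih _ => exact sup_le (fun x hx => filt_le _ (ih hx)) (key (N + 2))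
  exact fun {N x} hx => main N hx

theorem one_mem_filt : (1 : Fun q) ∈ filt q 0 := by
  simpa using pow_a_mem (q := q) 0 0 0

/-- Induction on the filtration: a property that is linear in each degree, holds for `1`, and is
preserved by multiplication by generators and by raising the degree by two. -/
theorem filt_induction (P : ℕ → Submodule ℂ (Fun q)) (one : 1 ∈ P 0)
    (mul : ∀ N g, ∀ x ∈ filt q N, x ∈ P N → gen q g * x ∈ P (N + 1))
    (le : ∀ N, ∀ x ∈ filt q N, x ∈ P N → x ∈ P (N + 2)) (N : ℕ) : filt q N ≤ P N := by
  -- Membership in `filt` is carried along because `mul` requires it.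
  have hpow (g : Gen) (r : ℕ) {n : ℕ} {x : Fun q} (hx : x ∈ filt q n ⊓ P n) :
      gen q g ^ r * x ∈ filt q (r + n) ⊓ P (r + n) := by
    induction r with
    | zero => simpa using hx
    | succ r ih =>
      rw [pow_succ', mul_assoc, show r + 1 + n = r + n + 1 by omega]
      exact ⟨gen_mul_mem_filt g ih.1, mul _ g _ ih.1 ih.2⟩
  have hword (g : Gen) (r t p : ℕ) :
      b q ^ r * (c q ^ t * gen q g ^ p) ∈ P (r + t + p) := by
    have h := hpow .b r (hpow .c t (hpow g p (x := 1) ⟨one_mem_filt, one⟩))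
    rw [mul_one, add_zero, ← add_assoc] at h
    exact h.2
  have key (N : ℕ) : homogeneousPart q N ≤ P N :=
    homogeneousPart_induction (by rintro r t p rfl; exact hword .a r t p)
      (by rintro r t p rfl; exact hword .d r t p)
  induction N using Nat.twoStepInduction with
  | zero => exact key 0
  | one => exact key 1
  | more N ih _ => exact sup_le (fun x hx => le _ _ hx (ih hx)) (key (N + 2))

theorem exists_mem_filt (x : Fun q) :
    ∃ n : ℕ, ∃ y ∈ filt q (2 * n), ∃ z ∈ filt q (2 * n + 1), x = y + z := by
  -- Each `filt q N` sees one parity only; joining two consecutive ones gives an increasing chain,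
  -- whose supremum is a union.
  have hmono : Monotone fun N => filt q N ⊔ filt q (N + 1) :=
    monotone_nat_of_le_succ fun N => sup_le (le_sup_of_le_right (filt_le N)) le_sup_left
  have hx : x ∈ ⨆ N, filt q N ⊔ filt q (N + 1) := by
    refine mem_of_stable _ ?_ ?_ x
    · exact Submodule.mem_iSup_of_mem 0 (Submodule.mem_sup_left one_mem_filt)
    · intro g x hx
      rw [Submodule.mem_iSup_of_directed _ hmono.directed_le] at hx
      obtain ⟨N, hN⟩ := hx
      obtain ⟨y, hy, z, hz, rfl⟩ := Submodule.mem_sup.mp hN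
      refine Submodule.mem_iSup_of_mem (N + 1) (Submodule.mem_sup.mpr ?_)
      exact ⟨_, gen_mul_mem_filt g hy, _, gen_mul_mem_filt g hz, (mul_add _ _ _).symm⟩
  rw [Submodule.mem_iSup_of_directed _ hmono.directed_le] at hx
  obtain ⟨N, hN⟩ := hx
  -- Passing from `N` to `2 * N` makes the first summand the even one.
  obtain ⟨y, hy, z, hz, h⟩ := Submodule.mem_sup.mp (hmono (show N ≤ 2 * N by omega) hN)
  exact ⟨N, y, hy, z, hz, h.symm⟩

end filtration

/-! ### Top-degree symbols -/

section symbols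

variable {q : Circle}

theorem coef_of_mem_filt {N : ℕ} {x : Fun q} (hx : x ∈ filt q N) {n : ℤ} (hn : N < n) (i j : ℤ) :
    coef q x n i j = 0 := by
  let P (N : ℕ) : Submodule ℂ (Fun q) :=
    { carrier := {x | ∀ n i j : ℤ, N < n → coef q x n i j = 0}
      zero_mem' := by simp
      add_mem' := fun {x y} hx hy n i j hn => by simp [hx n i j hn, hy n i j hn]
      smul_mem' := fun z x hx n i j hn => by simp [hx n i j hn] }
  refine filt_induction P ?_ ?_ ?_ N hx n i j hn
  · intro n i j hn
    rw [coef_one, originVec, if_neg (by omega)]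
  · intro N g x _ hx n i j hn
    push_cast at hn
    have h := hx (n - 1)
    cases g
    · rw [coef_a_mul, h _ _ (by omega)]
    · rw [coef_b_mul, h _ _ (by omega), mul_zero]
    · rw [coef_c_mul, h _ _ (by omega), mul_zero]
    · rw [coef_d_mul, h _ _ (by omega), hx _ _ _ (by omega), mul_zero, zero_add]
  · intro N x _ hx n i j hn
    exact hx n i j (by push_cast at hn; omega)

/-- In top degree the degree-lowering summand of `d` reads a coefficient of `x` in degree `N + 2`,
which is zero. -/
theorem coef_d_mul_top {N : ℕ} {x : Fun q} (hx : x ∈ filt q N) (i j : ℤ) :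
    coef q (d q * x) (N + 1) i j =
      (q : ℂ) ^ (i + j - 2 * (N + 1 : ℤ)) * coef q x N (i - 1) (j - 1) := by
  rw [coef_d_mul, coef_of_mem_filt hx (n := N + 1 + 1) (by omega), add_zero,
    add_sub_cancel_right]

theorem coef_pow_b_mul (r : ℕ) (x : Fun q) (N i j : ℤ) :
    coef q (b q ^ r * x) N i j = (q : ℂ) ^ (r * (j - N)) * coef q x (N - r) i (j - r) := by
  induction r generalizing N j with
  | zero => simp
  | succ r ih =>
    rw [pow_succ', mul_assoc, coef_b_mul, ih, ← mul_assoc, ← zpow_add₀ q.coe_ne_zero]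
    push_cast
    congr 2 <;> ring_nf

theorem coef_pow_c_mul (t : ℕ) (x : Fun q) (N i j : ℤ) :
    coef q (c q ^ t * x) N i j = (q : ℂ) ^ (t * (i - N)) * coef q x (N - t) (i - t) j := by
  induction t generalizing N i with
  | zero => simp
  | succ t ih =>
    rw [pow_succ', mul_assoc, coef_c_mul, ih, ← mul_assoc, ← zpow_add₀ q.coe_ne_zero]
    push_cast
    congr 2 <;> ring_nf

theorem coef_pow_a (p : ℕ) (i j : ℤ) :
    coef q (a q ^ p) p i j = if i = 0 ∧ j = 0 then 1 else 0 := by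
  induction p with
  | zero => simp [coef_one, originVec]
  | succ p ih =>
    rw [pow_succ', coef_a_mul]
    push_cast
    rw [add_sub_cancel_right, ih]

theorem pow_d_mem_filt (p : ℕ) : d q ^ p ∈ filt q p := by
  simpa using pow_d_mem (q := q) 0 0 p

theorem coef_pow_d (p : ℕ) (i j : ℤ) :
    coef q (d q ^ p) p i j = if i = p ∧ j = p then 1 else 0 := by
  induction p generalizing i j with
  | zero => simp [coef_one, originVec]
  | succ p ih =>
    rw [pow_succ']
    push_cast
    rw [coef_d_mul_top (pow_d_mem_filt p), ih]
    by_cases h : i - 1 = p ∧ j - 1 = p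
    · rw [if_pos h, if_pos (by omega), show i + j - 2 * ((p : ℤ) + 1) = 0 by omega]
      simp
    · rw [if_neg h, if_neg (by omega), mul_zero]

/-- The symbols of the monomials of degree `N` are nonzero multiples of distinct indicator
functions, so these monomials are independent modulo lower degree. -/
theorem coef_normalMonomial {N i j : ℕ} (hi : i ≤ N) (hj : j ≤ N) :
    ∃ κ : ℂ, κ ≠ 0 ∧ ∀ i' j' : ℤ,
      coef q (normalMonomial q N i j) N i' j' = if i' = i ∧ j' = j then κ else 0 := by
  have hq : (q : ℂ) ≠ 0 := q.coe_ne_zero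
  by_cases h : i + j ≤ N
  · obtain ⟨p, rfl⟩ : ∃ p, N = j + i + p := ⟨N - i - j, by omega⟩
    refine ⟨(q : ℂ) ^ (j * ((j : ℤ) - (j + i + p : ℕ))) *
      (q : ℂ) ^ (i * ((i : ℤ) - ((j + i + p : ℕ) - j))),
      mul_ne_zero (zpow_ne_zero _ hq) (zpow_ne_zero _ hq), fun i' j' => ?_⟩
    rw [normalMonomial_a, coef_pow_b_mul, coef_pow_c_mul,
      show ((j + i + p : ℕ) : ℤ) - j - i = p by push_cast; ring, coef_pow_a]
    by_cases h : i' = i ∧ j' = j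
    · obtain ⟨rfl, rfl⟩ := h
      simp
    · rw [if_neg h, if_neg (by omega), mul_zero, mul_zero]
  · obtain ⟨p, r, t, rfl, rfl, rfl⟩ : ∃ p r t, N = r + t + p ∧ i = t + p ∧ j = r + p :=
      ⟨i + j - N, N - i, N - j, by omega, by omega, by omega⟩
    refine ⟨(q : ℂ) ^ (r * (((r + p : ℕ) : ℤ) - (r + t + p : ℕ))) *
      (q : ℂ) ^ (t * (((t + p : ℕ) : ℤ) - ((r + t + p : ℕ) - r))),
      mul_ne_zero (zpow_ne_zero _ hq) (zpow_ne_zero _ hq), fun i' j' => ?_⟩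
    rw [normalMonomial_d, coef_pow_b_mul, coef_pow_c_mul,
      show ((r + t + p : ℕ) : ℤ) - r - t = p by push_cast; ring, coef_pow_d]
    by_cases h : i' = (t + p : ℕ) ∧ j' = (r + p : ℕ)
    · obtain ⟨rfl, rfl⟩ := h
      simp
    · rw [if_neg h, if_neg (by push_cast at h; omega), mul_zero, mul_zero]

theorem mem_filt_of_coef_eq_zero {N : ℕ} {x : Fun q} (hx : x ∈ filt q (N + 2))
    (h : ∀ i j : ℕ, i ≤ N + 2 → j ≤ N + 2 → coef q x (N + 2 : ℕ) i j = 0) : x ∈ filt q N := by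
  obtain ⟨y, hy, u, hu, rfl⟩ := Submodule.mem_sup.mp hx
  obtain ⟨α, rfl⟩ := (Submodule.mem_span_range_iff_exists_fun ℂ).mp hu
  suffices hα : α = 0 by simpa [hα] using hy
  funext ⟨⟨i, hi⟩, ⟨j, hj⟩⟩
  have hij := h i j (by omega) (by omega)
  rw [map_add, Pi.add_apply, Pi.add_apply, Pi.add_apply,
    coef_of_mem_filt hy (by push_cast; omega), zero_add, map_sum, Finset.sum_apply,
    Finset.sum_apply, Finset.sum_apply, Finset.sum_eq_single (⟨i, hi⟩, ⟨j, hj⟩)] at hij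
  · obtain ⟨κ, hκ, hcoef⟩ := coef_normalMonomial (q := q) (N := N + 2) (i := i) (j := j)
      (by omega) (by omega)
    rw [map_smul, Pi.smul_apply, Pi.smul_apply, Pi.smul_apply, hcoef, if_pos ⟨rfl, rfl⟩] at hij
    exact (smul_eq_zero.mp hij).resolve_right hκ
  · rintro ⟨⟨k, hk⟩, ⟨l, hl⟩⟩ - hne
    obtain ⟨κ, -, hcoef⟩ := coef_normalMonomial (q := q) (N := N + 2) (i := k) (j := l)
      (by omega) (by omega)
    rw [map_smul, Pi.smul_apply, Pi.smul_apply, Pi.smul_apply, hcoef, if_neg, smul_zero]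
    rintro ⟨h₁, h₂⟩
    exact hne (by simp only [Prod.mk.injEq, Fin.mk.injEq]; omega)
  · simp

end symbols

/-! ### Two functionals vanishing on the right ideal, and their actions -/

section functionals

variable (q s : Circle) (μ ν : ℝ)

/-- The values on the generators of the character `-ε`. -/
def oddCharGen : Gen → ℂ
  | .a => -1
  | .b => 0
  | .c => 0
  | .d => -1

/-- The character with value `-ε` on the generators. -/
def oddChar : Fun q →ₐ[ℂ] ℂ :=
  lift oddCharGen (by simp [oddCharGen]) (by simp [oddCharGen]) (by simp [oddCharGen])
    (by simp [oddCharGen]) (by simp [oddCharGen]) (by simp [oddCharGen]) (by simp [oddCharGen])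

theorem oddChar_gen (g : Gen) : oddChar q (gen q g) = oddCharGen g := by simp [oddChar]

/-- The values on the generators of the triangular representation whose corner is a skew
derivation vanishing on the coideal. -/
def triGen : Gen → Matrix (Fin 2) (Fin 2) ℂ
  | .a => !![1, -2 * s * μ * (q - 1); 0, (q : ℂ)⁻¹]
  | .b => !![0, q ^ 2 - 1; 0, 0]
  | .c => !![0, -q * ν * (q ^ 2 - 1); 0, 0]
  | .d => !![1, 2 * s * q * μ * (q - 1); 0, q]

/-- The triangular representation `x ↦ (ε x, Y x; 0, χ x)` whose corner `Y` is a skew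
derivation vanishing on the coideal. -/
def triHom : Fun q →ₐ[ℂ] Matrix (Fin 2) (Fin 2) ℂ := by
  have hq : (q : ℂ) ≠ 0 := q.coe_ne_zero
  refine lift (triGen q s μ ν) ?_ ?_ ?_ ?_ ?_ ?_ ?_ <;>
  · ext i j
    fin_cases i <;> fin_cases j <;> simp [triGen] <;> field_simp <;> ring

theorem triHom_gen (g : Gen) : triHom q s μ ν (gen q g) = triGen q s μ ν g := by
  simp [triHom]

/-- The skew derivation in the corner of the triangular representation. -/
def skewDer : Fun q →ₗ[ℂ] ℂ :=
  Matrix.entryLinearMap ℂ ℂ 0 1 ∘ₗ (triHom q s μ ν).toLinearMap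

/-- The character by which the skew derivation is twisted. -/
def twistChar : Fun q →ₗ[ℂ] ℂ :=
  Matrix.entryLinearMap ℂ ℂ 1 1 ∘ₗ (triHom q s μ ν).toLinearMap

variable {q s μ ν}

theorem skewDer_one : skewDer q s μ ν 1 = 0 := by simp [skewDer]

theorem twistChar_one : twistChar q s μ ν 1 = 1 := by simp [twistChar]

/-- The corner entry of a product of triangular matrices: `Y (g x) = ε g * Y x + Y g * χ x`. If `ε`
and `Y` vanish on the coideal, then `Y` vanishes on the whole right ideal. -/
theorem skewDer_comp (g : Gen) : skewDer q s μ ν ∘ₗ LinearMap.mulLeft ℂ (gen q g) =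
    triGen q s μ ν g 0 0 • skewDer q s μ ν + triGen q s μ ν g 0 1 • twistChar q s μ ν := by
  ext x
  simp [skewDer, twistChar, triHom_gen, Matrix.mul_apply, Fin.sum_univ_two]

theorem twistChar_comp (g : Gen) : twistChar q s μ ν ∘ₗ LinearMap.mulLeft ℂ (gen q g) =
    triGen q s μ ν g 1 1 • twistChar q s μ ν := by
  ext x
  have h : triGen q s μ ν g 1 0 = 0 := by cases g <;> rfl
  simp [twistChar, triHom_gen, Matrix.mul_apply, Fin.sum_univ_two, h]

theorem oddChar_comp (g : Gen) : (oddChar q).toLinearMap ∘ₗ LinearMap.mulLeft ℂ (gen q g) =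
    oddCharGen g • (oddChar q).toLinearMap := by
  ext x
  simp [oddChar_gen]

/-- Contraction with this character multiplies each generator by `-1`, and all monomials in `filt q
N` have degree of the parity of `N`. -/
theorem act_oddChar_of_mem_filt {N : ℕ} {x : Fun q} (hx : x ∈ filt q N) :
    act (oddChar q).toLinearMap x = (-1 : ℂ) ^ N • x := by
  let P (N : ℕ) : Submodule ℂ (Fun q) :=
    LinearMap.ker (act (oddChar q).toLinearMap - (-1 : ℂ) ^ N • LinearMap.id)
  have hP (N : ℕ) (x : Fun q) :
      x ∈ P N ↔ act (oddChar q).toLinearMap x = (-1 : ℂ) ^ N • x := by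
    simp [P, sub_eq_zero]
  rw [← hP]
  refine filt_induction P ?_ ?_ ?_ N hx
  · simp [hP, act_one]
  · intro N g x _ hx
    rw [hP] at hx ⊢
    cases g <;>
    simp [act_a_mul, act_b_mul, act_c_mul, act_d_mul, oddChar_comp, oddCharGen, act_smul, act_neg,
      act_zero, hx, pow_succ]
  · intro N x _ hx
    rw [hP] at hx ⊢
    simpa [pow_add] using hx

theorem act_skewDer_a_mul (x : Fun q) : act (skewDer q s μ ν) (a q * x) =
    a q * act (skewDer q s μ ν) x +
      ((-2 * s * μ * (q - 1) : ℂ) • (a q * act (twistChar q s μ ν) x) +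
      (-q * ν * (q ^ 2 - 1) : ℂ) • (b q * act (twistChar q s μ ν) x)) := by
  rw [act_a_mul, skewDer_comp, skewDer_comp]
  simp [act_add, act_smul, act_neg, triGen, mul_add, act_zero, add_assoc]

theorem act_skewDer_b_mul (x : Fun q) : act (skewDer q s μ ν) (b q * x) =
    b q * act (skewDer q s μ ν) x +
      ((q ^ 2 - 1 : ℂ) • (a q * act (twistChar q s μ ν) x) +
      (2 * s * q * μ * (q - 1) : ℂ) • (b q * act (twistChar q s μ ν) x)) := by
  rw [act_b_mul, skewDer_comp, skewDer_comp]
  simp [act_add, act_smul, triGen, mul_add, act_zero]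
  abel

theorem act_skewDer_c_mul (x : Fun q) : act (skewDer q s μ ν) (c q * x) =
    c q * act (skewDer q s μ ν) x +
      ((-2 * s * μ * (q - 1) : ℂ) • (c q * act (twistChar q s μ ν) x) +
      (-q * ν * (q ^ 2 - 1) : ℂ) • (d q * act (twistChar q s μ ν) x)) := by
  rw [act_c_mul, skewDer_comp, skewDer_comp]
  simp [act_add, act_smul, act_neg, triGen, mul_add, act_zero, add_assoc]

theorem act_skewDer_d_mul (x : Fun q) : act (skewDer q s μ ν) (d q * x) =
    d q * act (skewDer q s μ ν) x +
      ((q ^ 2 - 1 : ℂ) • (c q * act (twistChar q s μ ν) x) +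
      (2 * s * q * μ * (q - 1) : ℂ) • (d q * act (twistChar q s μ ν) x)) := by
  rw [act_d_mul, skewDer_comp, skewDer_comp]
  simp [act_add, act_smul, triGen, mul_add, act_zero]
  abel

theorem act_twistChar_a_mul (x : Fun q) : act (twistChar q s μ ν) (a q * x) =
    (q : ℂ)⁻¹ • (a q * act (twistChar q s μ ν) x) := by
  simp [act_a_mul, twistChar_comp, act_smul, triGen, act_zero]

theorem act_twistChar_b_mul (x : Fun q) : act (twistChar q s μ ν) (b q * x) =
    (q : ℂ) • (b q * act (twistChar q s μ ν) x) := by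
  simp [act_b_mul, twistChar_comp, act_smul, triGen, act_zero]

theorem act_twistChar_c_mul (x : Fun q) : act (twistChar q s μ ν) (c q * x) =
    (q : ℂ)⁻¹ • (c q * act (twistChar q s μ ν) x) := by
  simp [act_c_mul, twistChar_comp, act_smul, triGen, act_zero]

theorem act_twistChar_d_mul (x : Fun q) : act (twistChar q s μ ν) (d q * x) =
    (q : ℂ) • (d q * act (twistChar q s μ ν) x) := by
  simp [act_d_mul, twistChar_comp, act_smul, triGen, act_zero]

theorem act_twistChar_mem_filt {N : ℕ} {x : Fun q} (hx : x ∈ filt q N) :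
    act (twistChar q s μ ν) x ∈ filt q N := by
  refine filt_induction (fun N => (filt q N).comap (act (twistChar q s μ ν))) ?_ ?_ ?_ N hx
  · simpa [act_one, twistChar_one] using one_mem_filt
  · intro N g x _ hx
    have h := gen_mul_mem_filt g hx
    cases g <;>
    simp only [Submodule.mem_comap, act_twistChar_a_mul, act_twistChar_b_mul,
      act_twistChar_c_mul, act_twistChar_d_mul] <;>
    exact Submodule.smul_mem _ _ h
  · intro N x _ hx
    exact filt_le N hx

/-- The twist scales `b, d` by `q` and `a, c` by `q⁻¹`, hence the weight `j - (N - j)`. Both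
summands of `d` respect this weight, so the formula holds in every degree and not just the top one.
-/
theorem coef_act_twistChar (x : Fun q) (N i j : ℤ) :
    coef q (act (twistChar q s μ ν) x) N i j = (q : ℂ) ^ (2 * j - N) * coef q x N i j := by
  have hq : (q : ℂ) ≠ 0 := q.coe_ne_zero
  let S : Submodule ℂ (Fun q) :=
    { carrier := {x | ∀ N i j : ℤ, coef q (act (twistChar q s μ ν) x) N i j =
        (q : ℂ) ^ (2 * j - N) * coef q x N i j}
      zero_mem' := by simp
      add_mem' := fun {x y} hx hy N i j => by simp [hx N i j, hy N i j, mul_add]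
      smul_mem' := fun z x hx N i j => by simp [hx N i j, mul_left_comm] }
  refine mem_of_stable S ?_ ?_ x N i j
  · intro N i j
    simp only [act_one, twistChar_one, one_smul, coef_one, originVec]
    split_ifs with h
    · simp [h.1, h.2.2]
    · simp
  · intro g x hx N i j
    cases g
    · rw [act_twistChar_a_mul, map_smul, Pi.smul_apply, Pi.smul_apply, Pi.smul_apply, coef_a_mul,
        hx, coef_a_mul, smul_eq_mul, zpow_sub₀ hq, zpow_sub₀ hq, zpow_sub₀ hq]
      field_simp
    · rw [act_twistChar_b_mul, map_smul, Pi.smul_apply, Pi.smul_apply, Pi.smul_apply, coef_b_mul,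
        hx, coef_b_mul, smul_eq_mul]
      simp only [mul_sub, zpow_sub₀ hq, zpow_mul, zpow_one]
      field_simp
    · rw [act_twistChar_c_mul, map_smul, Pi.smul_apply, Pi.smul_apply, Pi.smul_apply, coef_c_mul,
        hx, coef_c_mul, smul_eq_mul]
      simp only [mul_sub, zpow_sub₀ hq, zpow_mul, zpow_one]
      field_simp
    · rw [act_twistChar_d_mul, map_smul, Pi.smul_apply, Pi.smul_apply, Pi.smul_apply, coef_d_mul,
        hx, hx, coef_d_mul, smul_eq_mul]
      simp only [mul_sub, zpow_sub₀ hq, zpow_add₀ hq, zpow_mul, zpow_one]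
      field_simp

theorem act_skewDer_mem_filt {N : ℕ} {x : Fun q} (hx : x ∈ filt q N) :
    act (skewDer q s μ ν) x ∈ filt q N := by
  refine filt_induction (fun N => (filt q N).comap (act (skewDer q s μ ν))) ?_ ?_ ?_ N hx
  · simp [act_one, skewDer_one]
  · intro N g x hx hDx
    have h₁ (g : Gen) := gen_mul_mem_filt g hDx
    have h₂ (g : Gen) := gen_mul_mem_filt g
      (act_twistChar_mem_filt (s := s) (μ := μ) (ν := ν) hx)
    cases g <;>
    simp only [Submodule.mem_comap, act_skewDer_a_mul, act_skewDer_b_mul,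
      act_skewDer_c_mul, act_skewDer_d_mul] <;>
    exact add_mem (h₁ _) (add_mem (Submodule.smul_mem _ _ (h₂ _)) (Submodule.smul_mem _ _ (h₂ _)))
  · intro N x _ hx
    exact filt_le N hx

end functionals

/-! ### The kernel of the skew derivation is generated by the `zᵢ` -/

section kernel

variable {q s : Circle} {μ ν : ℝ}

/-- The skew derivation mixes the columns of the generating matrix and keeps its rows, so `i` is
fixed. The three terms replace a factor `b, d` by `a, c`, keep the column, or replace `a, c` by `b,
d`. The formula concerns the top degree only, where `d` acts by a single shift. -/
theorem coef_act_skewDer {N : ℕ} {x : Fun q} (hx : x ∈ filt q N) (i j : ℤ) :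
    coef q (act (skewDer q s μ ν) x) N i j =
      q * ((q : ℂ) ^ (j + 1) - (q : ℂ) ^ (-(j + 1))) * coef q x N i (j + 1)
      + 2 * s * μ * q * ((q : ℂ) ^ (2 * j - N) - 1) * coef q x N i j
      - ν * (q : ℂ) ^ (j + 2) * (1 - (q : ℂ) ^ (-2 * (N - j + 1))) * coef q x N i (j - 1) := by
  have hq : (q : ℂ) ≠ 0 := q.coe_ne_zero
  let P (N : ℕ) : Submodule ℂ (Fun q) :=
    { carrier := {x | ∀ i j : ℤ, coef q (act (skewDer q s μ ν) x) N i j =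
        q * ((q : ℂ) ^ (j + 1) - (q : ℂ) ^ (-(j + 1))) * coef q x N i (j + 1)
        + 2 * s * μ * q * ((q : ℂ) ^ (2 * j - N) - 1) * coef q x N i j
        - ν * (q : ℂ) ^ (j + 2) * (1 - (q : ℂ) ^ (-2 * (N - j + 1))) * coef q x N i (j - 1)}
      zero_mem' := by simp
      add_mem' := fun {x y} hx hy i j => by
        simp only [map_add, Pi.add_apply, hx i j, hy i j]; ring
      smul_mem' := fun z x hx i j => by
        simp only [map_smul, Pi.smul_apply, smul_eq_mul, hx i j]; ring }
  refine filt_induction P ?_ ?_ ?_ N hx i j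
  · intro i j
    simp only [act_one, skewDer_one, zero_smul, map_zero, coef_one, originVec, Pi.zero_apply]
    -- For `x = 1` the right side meets the origin only at `j = 0, -1, 1`, and in each case the
    -- coefficient in front is zero.
    by_cases h₀ : j = 0
    · subst h₀; simp
    by_cases h₁ : j = -1
    · subst h₁; simp
    by_cases h₂ : j = 1
    · subst h₂; simp
    rw [if_neg (by omega), if_neg (by omega), if_neg (by omega)]
    simp
  · intro N g x hxN hx i j
    replace hx : ∀ i j : ℤ, coef q (act (skewDer q s μ ν) x) N i j =
        q * ((q : ℂ) ^ (j + 1) - (q : ℂ) ^ (-(j + 1))) * coef q x N i (j + 1)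
        + 2 * s * μ * q * ((q : ℂ) ^ (2 * j - N) - 1) * coef q x N i j
        - ν * (q : ℂ) ^ (j + 2) * (1 - (q : ℂ) ^ (-2 * (N - j + 1))) * coef q x N i (j - 1) := hx
    have hσ : act (twistChar q s μ ν) x ∈ filt q N := act_twistChar_mem_filt hxN
    have hD : act (skewDer q s μ ν) x ∈ filt q N := act_skewDer_mem_filt hxN
    push_cast
    cases g
    · change coef q (act (skewDer q s μ ν) (a q * x)) _ _ _ = _ * coef q (a q * x) _ _ _ +
        _ * coef q (a q * x) _ _ _ - _ * coef q (a q * x) _ _ _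
      simp only [act_skewDer_a_mul, map_add, map_smul, Pi.add_apply, Pi.smul_apply, smul_eq_mul,
        coef_a_mul, coef_b_mul, coef_act_twistChar, add_sub_cancel_right, hx i j]
      simp only [mul_add, mul_sub, neg_mul, zpow_neg, zpow_sub₀ hq, zpow_add₀ hq, zpow_mul',
        zpow_ofNat, zpow_one]
      field_simp
      ring
    · change coef q (act (skewDer q s μ ν) (b q * x)) _ _ _ = _ * coef q (b q * x) _ _ _ +
        _ * coef q (b q * x) _ _ _ - _ * coef q (b q * x) _ _ _
      simp only [act_skewDer_b_mul, map_add, map_smul, Pi.add_apply, Pi.smul_apply, smul_eq_mul,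
        coef_a_mul, coef_b_mul, coef_act_twistChar, add_sub_cancel_right, sub_add_cancel, hx]
      simp only [mul_add, mul_sub, neg_mul, zpow_neg, zpow_sub₀ hq, zpow_add₀ hq, zpow_mul',
        zpow_ofNat, zpow_one]
      field_simp
      ring
    · change coef q (act (skewDer q s μ ν) (c q * x)) _ _ _ = _ * coef q (c q * x) _ _ _ +
        _ * coef q (c q * x) _ _ _ - _ * coef q (c q * x) _ _ _
      simp only [act_skewDer_c_mul, map_add, map_smul, Pi.add_apply, Pi.smul_apply, smul_eq_mul,
        coef_c_mul, coef_d_mul_top hσ, coef_act_twistChar, add_sub_cancel_right, sub_add_cancel,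
        hx]
      simp only [mul_add, mul_sub, neg_mul, zpow_neg, zpow_sub₀ hq, zpow_add₀ hq, zpow_mul',
        zpow_ofNat, zpow_one]
      field_simp
      ring
    · change coef q (act (skewDer q s μ ν) (d q * x)) _ _ _ = _ * coef q (d q * x) _ _ _ +
        _ * coef q (d q * x) _ _ _ - _ * coef q (d q * x) _ _ _
      simp only [act_skewDer_d_mul, map_add, map_smul, Pi.add_apply, Pi.smul_apply, smul_eq_mul,
        coef_c_mul, coef_d_mul_top hσ, coef_d_mul_top hD, coef_d_mul_top hxN, coef_act_twistChar,
        add_sub_cancel_right, sub_add_cancel, hx]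
      simp only [mul_add, mul_sub, neg_mul, zpow_neg, zpow_sub₀ hq, zpow_add₀ hq, zpow_mul',
        zpow_ofNat, zpow_one]
      field_simp
      ring
  · intro N x hxN _ i j
    have hD : act (skewDer q s μ ν) x ∈ filt q N := act_skewDer_mem_filt hxN
    rw [coef_of_mem_filt hD (by push_cast; omega), coef_of_mem_filt hxN (by push_cast; omega),
      coef_of_mem_filt hxN (by push_cast; omega), coef_of_mem_filt hxN (by push_cast; omega)]
    simp

variable (hq : ∀ n : ℕ, 0 < n → q ^ n ≠ 1)

include hq in
theorem zpow_sub_zpow_neg_ne_zero (j : ℕ) :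
    (q : ℂ) ^ ((j : ℤ) + 1) - (q : ℂ) ^ (-((j : ℤ) + 1)) ≠ 0 := by
  intro h
  have h0 : (q : ℂ) ^ (j + 1) ≠ 0 := pow_ne_zero _ q.coe_ne_zero
  refine hq (2 * (j + 1)) (by omega) (Circle.ext ?_)
  rw [zpow_neg, show (j : ℤ) + 1 = ((j + 1 : ℕ) : ℤ) by push_cast; rfl, zpow_natCast,
    sub_eq_zero, ← mul_eq_one_iff_eq_inv₀ h0] at h
  rw [Circle.coe_pow, Circle.coe_one, two_mul, pow_add, h]

include hq in
theorem coef_eq_zero_of_act_skewDer_eq_zero {N : ℕ} {x : Fun q} (hx : x ∈ filt q N)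
    (hD : act (skewDer q s μ ν) x = 0) {i : ℤ} (h : coef q x N i 0 = 0) (j : ℕ) :
    coef q x N i j = 0 := by
  -- A three-term recurrence needs two consecutive zeros; the one at `j = -1` is automatic.
  suffices coef q x N i ((j : ℤ) - 1) = 0 ∧ coef q x N i j = 0 from this.2
  induction j with
  | zero => exact ⟨coef_of_neg x (by simp) _ _, h⟩
  | succ j ih =>
    push_cast
    rw [add_sub_cancel_right]
    refine ⟨ih.2, ?_⟩
    have key := coef_act_skewDer (s := s) (μ := μ) (ν := ν) hx i j
    rw [hD, ih.1, ih.2, map_zero, mul_zero, mul_zero, add_zero, sub_zero] at key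
    exact (mul_eq_zero.mp key.symm).resolve_left
      (mul_ne_zero q.coe_ne_zero (zpow_sub_zpow_neg_ne_zero hq j))

theorem coef_b_mul_zero (x : Fun q) (N i : ℤ) : coef q (b q * x) N i 0 = 0 := by
  rw [coef_b_mul, coef_of_neg _ (by omega), mul_zero]

theorem coef_d_mul_top_zero {N : ℕ} {x : Fun q} (hx : x ∈ filt q N) (i : ℤ) :
    coef q (d q * x) (N + 1) i 0 = 0 := by
  rw [coef_d_mul_top hx, coef_of_neg _ (by omega), mul_zero]

/-- In these expansions every word containing `b` or `d` is written with such a letter outermost, so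
its top coefficient at `j = 0` vanishes at once. -/
theorem z₁_mul_eq (x : Fun q) : z₁ q s μ ν * x = (s : ℂ)⁻¹ • (gen q .a * (gen q .c * x)) +
    (((s : ℂ)⁻¹ * ν) • (gen q .b * (gen q .d * x)) + (2 * μ : ℂ) • (gen q .b * (gen q .c * x))) := by
  simp only [z₁, add_mul, smul_add, smul_mul_assoc, mul_assoc, smul_smul, add_assoc]

theorem z₂_mul_eq (x : Fun q) : z₂ q s μ ν * x = gen q .c * (gen q .c * x) +
    ((ν : ℂ) • (gen q .d * (gen q .d * x)) +
      (2 * μ * (s : ℂ)⁻¹ * q : ℂ) • (gen q .d * (gen q .c * x))) := by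
  simp only [z₂, add_mul, smul_add, smul_mul_assoc, mul_assoc, rel_cd, smul_smul, pow_two,
    Circle.coe_inv, add_assoc]

theorem z₃_mul_eq (x : Fun q) : z₃ q s μ ν * x = gen q .a * (gen q .a * x) +
    ((ν : ℂ) • (gen q .b * (gen q .b * x)) +
      (2 * μ * (s : ℂ)⁻¹ * q : ℂ) • (gen q .b * (gen q .a * x))) := by
  simp only [z₃, add_mul, smul_add, smul_mul_assoc, mul_assoc, rel_ab, smul_smul, pow_two,
    Circle.coe_inv, add_assoc]

theorem z₁_mul_mem_filt {N : ℕ} {x : Fun q} (hx : x ∈ filt q N) :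
    z₁ q s μ ν * x ∈ filt q (N + 2) := by
  have h (g g' : Gen) := gen_mul_mem_filt g (gen_mul_mem_filt g' hx)
  rw [z₁_mul_eq]
  exact add_mem (Submodule.smul_mem _ _ (h _ _))
    (add_mem (Submodule.smul_mem _ _ (h _ _)) (Submodule.smul_mem _ _ (h _ _)))

theorem z₂_mul_mem_filt {N : ℕ} {x : Fun q} (hx : x ∈ filt q N) :
    z₂ q s μ ν * x ∈ filt q (N + 2) := by
  have h (g g' : Gen) := gen_mul_mem_filt g (gen_mul_mem_filt g' hx)
  rw [z₂_mul_eq]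
  exact add_mem (h _ _)
    (add_mem (Submodule.smul_mem _ _ (h _ _)) (Submodule.smul_mem _ _ (h _ _)))

theorem z₃_mul_mem_filt {N : ℕ} {x : Fun q} (hx : x ∈ filt q N) :
    z₃ q s μ ν * x ∈ filt q (N + 2) := by
  have h (g g' : Gen) := gen_mul_mem_filt g (gen_mul_mem_filt g' hx)
  rw [z₃_mul_eq]
  exact add_mem (h _ _)
    (add_mem (Submodule.smul_mem _ _ (h _ _)) (Submodule.smul_mem _ _ (h _ _)))

/-- In the column `j = 0`, top degree, only `a` and `c` survive. There `z₃`, `z₁`, `z₂` act as `a²`,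
`s⁻¹ a c`, `c²`, and shift `i` by `0`, `1`, `2`. -/
theorem coef_z₁_mul (x : Fun q) (N i : ℤ) :
    coef q (z₁ q s μ ν * x) (N + 2) i 0 =
      (s : ℂ)⁻¹ * (q : ℂ) ^ (i - (N + 1)) * coef q x N (i - 1) 0 := by
  rw [z₁_mul_eq]
  simp only [map_add, map_smul, Pi.add_apply, Pi.smul_apply, coef_b_mul_zero, coef_a_mul,
    coef_c_mul, smul_eq_mul, mul_zero, add_zero]
  rw [show N + 2 - 1 = N + 1 by ring, add_sub_cancel_right, mul_assoc]

theorem coef_z₂_mul {N : ℕ} {x : Fun q} (hx : x ∈ filt q N) (i : ℤ) :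
    coef q (z₂ q s μ ν * x) (N + 2) i 0 =
      (q : ℂ) ^ (i - (N + 2 : ℤ)) * (q : ℂ) ^ (i - 1 - (N + 1 : ℤ)) * coef q x N (i - 2) 0 := by
  have h (g : Gen) (i : ℤ) : coef q (d q * (gen q g * x)) (N + 2) i 0 = 0 := by
    have := coef_d_mul_top_zero (gen_mul_mem_filt g hx) i
    rwa [Nat.cast_add, Nat.cast_one, add_assoc, one_add_one_eq_two] at this
  rw [z₂_mul_eq]
  simp only [map_add, map_smul, Pi.add_apply, Pi.smul_apply, h, coef_c_mul, smul_zero, add_zero]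
  rw [show (N : ℤ) + 2 - 1 = N + 1 by ring, add_sub_cancel_right, mul_assoc,
    show i - 1 - 1 = i - 2 by ring]

theorem coef_z₃_mul (x : Fun q) (N i : ℤ) :
    coef q (z₃ q s μ ν * x) (N + 2) i 0 = coef q x N i 0 := by
  rw [z₃_mul_eq]
  simp only [map_add, map_smul, Pi.add_apply, Pi.smul_apply, coef_b_mul_zero, coef_a_mul,
    smul_zero, add_zero]
  rw [show N + 2 - 1 - 1 = N by ring]

variable (q s μ ν) in
-- From degree `2n` to `2n + 2`, multiplication by `z₃` keeps the old positions `k ≤ 2n`. The two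
-- new ones, `2n + 1` and `2n + 2`, come from `z₁` and `z₂` applied to the element at position `2n`.
theorem exists_mem_zAlgebra_coef (n : ℕ) : ∀ k ≤ 2 * n, ∃ p ∈ zAlgebra q s μ ν,
    p ∈ filt q (2 * n) ∧ ∃ κ : ℂ, κ ≠ 0 ∧
      ∀ i : ℤ, coef q p (2 * n : ℕ) i 0 = if i = k then κ else 0 := by
  have hq : (q : ℂ) ≠ 0 := q.coe_ne_zero
  have h₁ := z₁_mem_zAlgebra (q := q) (s := s) μ ν
  have h₂ := z₂_mem_zAlgebra (q := q) (s := s) μ ν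
  have h₃ := z₃_mem_zAlgebra (q := q) (s := s) μ ν
  induction n with
  | zero =>
    intro k hk
    obtain rfl : k = 0 := by omega
    exact ⟨1, one_mem _, one_mem_filt, 1, one_ne_zero, fun i => by simp [coef_one, originVec]⟩
  | succ n ih =>
    intro k hk
    have hN : ((2 * (n + 1) : ℕ) : ℤ) = (2 * n : ℕ) + 2 := by push_cast; ring
    rw [hN]
    by_cases hk₁ : k ≤ 2 * n
    · obtain ⟨p, hp, hpf, κ, hκ, hcoef⟩ := ih k hk₁
      exact ⟨_, mul_mem h₃ hp, z₃_mul_mem_filt hpf, κ, hκ, fun i => by rw [coef_z₃_mul, hcoef]⟩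
    · obtain ⟨p, hp, hpf, κ, hκ, hcoef⟩ := ih (2 * n) le_rfl
      by_cases hk₂ : k = 2 * n + 1
      · refine ⟨_, mul_mem h₁ hp, z₁_mul_mem_filt hpf,
          (s : ℂ)⁻¹ * (q : ℂ) ^ (k - ((2 * n : ℕ) + 1 : ℤ)) * κ,
          mul_ne_zero (mul_ne_zero (inv_ne_zero s.coe_ne_zero) (zpow_ne_zero _ hq)) hκ,
          fun i => ?_⟩
        rw [coef_z₁_mul, hcoef]
        by_cases hi : i = k
        · rw [if_pos (by omega), if_pos hi, hi]
        · rw [if_neg (by omega), if_neg hi, mul_zero]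
      · refine ⟨_, mul_mem h₂ hp, z₂_mul_mem_filt hpf,
          (q : ℂ) ^ (k - ((2 * n : ℕ) + 2 : ℤ)) * (q : ℂ) ^ (k - 1 - ((2 * n : ℕ) + 1 : ℤ)) * κ,
          mul_ne_zero (mul_ne_zero (zpow_ne_zero _ hq) (zpow_ne_zero _ hq)) hκ, fun i => ?_⟩
        rw [coef_z₂_mul hpf, hcoef]
        by_cases hi : i = k
        · rw [if_pos (by omega), if_pos hi, hi]
        · rw [if_neg (by omega), if_neg hi, mul_zero]

variable (hs : s ^ 2 = q)

theorem act_skewDer_of_mem_homogeneousSpace {x : Fun q} (hx : x ∈ homogeneousSpace q s μ ν) :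
    act (skewDer q s μ ν) x = 0 := by
  have h (g : Gen) (x : Fun q) : skewDer q s μ ν (gen q g * x) =
      triGen q s μ ν g 0 0 • skewDer q s μ ν x + triGen q s μ ν g 0 1 • twistChar q s μ ν x :=
    LinearMap.congr_fun (skewDer_comp g) x
  rw [act_of_mem_homogeneousSpace (f := skewDer q s μ ν) μ ν ?_ ?_ hx, skewDer_one, zero_smul]
  · intro x
    simp only [add_mul, sub_mul, smul_mul_assoc, map_add, map_sub, map_smul, h, triGen, smul_eq_mul,
      Matrix.of_apply, Matrix.cons_val_zero, Matrix.cons_val_one]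
    ring
  · intro x
    simp only [add_mul, sub_mul, smul_mul_assoc, map_add, map_sub, map_smul, h, triGen, smul_eq_mul,
      Matrix.of_apply, Matrix.cons_val_zero, Matrix.cons_val_one]
    ring

theorem act_oddChar_of_mem_homogeneousSpace {x : Fun q} (hx : x ∈ homogeneousSpace q s μ ν) :
    act (oddChar q).toLinearMap x = x := by
  rw [act_of_mem_homogeneousSpace (f := (oddChar q).toLinearMap) μ ν ?_ ?_ hx] <;>
    simp [oddChar_gen, oddCharGen]

/-- The action of `oddChar` fixes a coinvariant but negates its odd part, so that part is zero. -/
theorem exists_mem_filt_of_mem_homogeneousSpace {x : Fun q}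
    (hx : x ∈ homogeneousSpace q s μ ν) : ∃ n : ℕ, x ∈ filt q (2 * n) := by
  obtain ⟨n, y, hy, z, hz, rfl⟩ := exists_mem_filt x
  have h := act_oddChar_of_mem_homogeneousSpace hx
  rw [map_add, act_oddChar_of_mem_filt hy, act_oddChar_of_mem_filt hz, pow_succ, pow_mul] at h
  have hz : z = 0 := by
    have h' : -z = z := by simpa using h
    have h₂ : (2 : ℂ) • z = 0 := by rw [two_smul]; nth_rewrite 1 [← h']; exact neg_add_cancel z
    exact (smul_eq_zero.mp h₂).resolve_left two_ne_zero
  exact ⟨n, by simpa [hz] using hy⟩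

include hs in
theorem act_skewDer_of_mem_zAlgebra {x : Fun q} (hx : x ∈ zAlgebra q s μ ν) :
    act (skewDer q s μ ν) x = 0 :=
  act_skewDer_of_mem_homogeneousSpace (zAlgebra_le_homogeneousSpace μ ν hs hx)

include hq hs in
theorem mem_zAlgebra_of_act_skewDer_eq_zero (n : ℕ) {x : Fun q} (hx : x ∈ filt q (2 * n))
    (hD : act (skewDer q s μ ν) x = 0) : x ∈ zAlgebra q s μ ν := by
  induction n generalizing x with
  | zero =>
    have : filt q (2 * 0) ≤ (zAlgebra q s μ ν).toSubmodule :=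
      homogeneousPart_induction (N := 0)
        (fun r t p h => by
          obtain ⟨rfl, rfl, rfl⟩ : r = 0 ∧ t = 0 ∧ p = 0 := by omega
          simp)
        (fun r t p h => by
          obtain ⟨rfl, rfl, rfl⟩ : r = 0 ∧ t = 0 ∧ p = 0 := by omega
          simp)
    exact this hx
  | succ n ih =>
    choose p hpz hpf κ hκ hcoef using fun k : Fin (2 * (n + 1) + 1) =>
      exists_mem_zAlgebra_coef q s μ ν (n + 1) k (by omega)
    -- Chosen so that `x` and `y` have the same column `j = 0` in top degree; since `x - y` is still
    -- in the kernel, its whole symbol vanishes.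
    let y : Fun q := ∑ k : Fin (2 * (n + 1) + 1),
      (coef q x (2 * (n + 1) : ℕ) ((k : ℕ) : ℤ) 0 / κ k) • p k
    have hyz : y ∈ zAlgebra q s μ ν := sum_mem fun k _ => Subalgebra.smul_mem _ (hpz k) _
    have hyf : y ∈ filt q (2 * (n + 1)) := sum_mem fun k _ => Submodule.smul_mem _ _ (hpf k)
    have hxy : act (skewDer q s μ ν) (x - y) = 0 := by
      rw [map_sub, hD, act_skewDer_of_mem_zAlgebra hs hyz, sub_zero]
    suffices x - y ∈ filt q (2 * n) by
      simpa using add_mem (ih this hxy) hyz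
    refine mem_filt_of_coef_eq_zero (N := 2 * n) (sub_mem hx hyf) fun i j hi _ => ?_
    refine coef_eq_zero_of_act_skewDer_eq_zero hq (sub_mem hx hyf) hxy ?_ j
    rw [map_sub, Pi.sub_apply, Pi.sub_apply, Pi.sub_apply, sub_eq_zero, map_sum, Finset.sum_apply,
      Finset.sum_apply, Finset.sum_apply, Finset.sum_eq_single ⟨i, by omega⟩]
    · rw [map_smul, Pi.smul_apply, Pi.smul_apply, Pi.smul_apply, hcoef, if_pos rfl, smul_eq_mul,
        div_mul_cancel₀ _ (hκ _)]
    · intro k _ hk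
      rw [map_smul, Pi.smul_apply, Pi.smul_apply, Pi.smul_apply, hcoef, if_neg, smul_zero]
      intro h
      exact hk (Fin.ext (by simp only; omega))
    · simp

include hq hs in
theorem zAlgebra_eq_homogeneousSpace :
    (zAlgebra q s μ ν).toSubmodule = homogeneousSpace q s μ ν := by
  refine le_antisymm (zAlgebra_le_homogeneousSpace μ ν hs) fun x hx => ?_
  obtain ⟨n, hn⟩ := exists_mem_filt_of_mem_homogeneousSpace hx
  exact mem_zAlgebra_of_act_skewDer_eq_zero hq hs n hn (act_skewDer_of_mem_homogeneousSpace hx)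

end kernel

end SLq

end

theorem mainTheorem6 (q s : Circle) (hq : ∀ n : ℕ, 0 < n → q ^ n ≠ 1) (hs : s ^ 2 = q)
    (μ ν : ℝ) :
    -- the left comodule subalgebra of coinvariants is generated by `z₁, z₂, z₃`
    (Algebra.adjoin ℂ {SLq.z₁ q s μ ν, SLq.z₂ q s μ ν, SLq.z₃ q s μ ν}).toSubmodule
        = SLq.homogeneousSpace q s μ ν ∧
    (∀ x ∈ SLq.homogeneousSpace q s μ ν, Coalgebra.comul (R := ℂ) x ∈
      LinearMap.range ((SLq.homogeneousSpace q s μ ν).subtype.lTensor (SLq.Fun q))) ∧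
    -- the generators are real
    IsSelfAdjoint (SLq.z₁ q s μ ν) ∧ IsSelfAdjoint (SLq.z₂ q s μ ν) ∧
    IsSelfAdjoint (SLq.z₃ q s μ ν) ∧
    -- the relations
    SLq.z₁ q s μ ν * SLq.z₂ q s μ ν = ((q : ℂ) ^ 2) • (SLq.z₂ q s μ ν * SLq.z₁ q s μ ν) ∧
    SLq.z₁ q s μ ν * SLq.z₃ q s μ ν
      = ((q : ℂ) ^ (-2 : ℤ)) • (SLq.z₃ q s μ ν * SLq.z₁ q s μ ν) ∧
    SLq.z₃ q s μ ν * SLq.z₂ q s μ ν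
      = algebraMap ℂ (SLq.Fun q) (ν : ℂ) + ((q : ℂ) ^ 2) • SLq.z₁ q s μ ν ^ 2
        + (2 * μ * q : ℂ) • SLq.z₁ q s μ ν := by
  have h := SLq.zAlgebra_eq_homogeneousSpace (μ := μ) (ν := ν) hq hs
  refine ⟨h, ?_, SLq.isSelfAdjoint_z₁ μ ν hs, SLq.isSelfAdjoint_z₂ μ ν hs,
    SLq.isSelfAdjoint_z₃ μ ν hs, SLq.z₁_mul_z₂ μ ν hs, SLq.z₁_mul_z₃ μ ν hs,
    SLq.z₃_mul_z₂ μ ν hs⟩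
  -- The comodule property is known for the generated algebra, so the coinvariants are replaced by
  -- it.
  rw [← h]
  exact fun x hx => SLq.comul_mem_of_mem_zAlgebra μ ν hs hx
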